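/- **Theorem 1.1.** Let $n = 3\cdot 2^k$ or $n = 2^k$ for some integer $k \ge 1$. Equip $\mathbb{Z}_n$ with the normalized counting measure $\mu_n$, so that $\|f\|_p = \big(\frac1n\sum_{x\in\mathbb{Z}_n}|f(x)|^p\big)^{1/p}$ for $f:\mathbb{Z}_n\to\mathbb{C}$, and put $\chi_j(x) = e^{2\pi i jx/n}$ and $\psi_n(j) = \min(j, n-j)$ for $0\le j\le n-1$. For $t \ge 0$ let $P_t$ be the linear map $$P_t:\ \sum_{j=0}^{n-1} a_j\chi_j \ \longmapsto\ \sum_{j=0}^{n-1} e^{-t\psi_n(j)}a_j\chi_j .$$ Then, for all $1 < p \le q < \infty$ and all $t \ge 0$, $$\|P_t f\|_q \le \|f\|_p \ \text{ for every } f:\mathbb{Z}_n\to\mathbb{C} \quad\Longleftrightarrow\quad t \ge \frac12\log\Big(\frac{q-1}{p-1}\Big).$$ -/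

import Mathlib

open MeasureTheory ZMod
open scoped ENNReal

noncomputable section

/-- The word length `ψ_n(k) = min (k, n - k)` on `ℤ/nℤ`, where `k` is represented in
`{0, …, n - 1}` (so the subtraction is a genuine one). -/
def wordLength (n : ℕ) (k : ZMod n) : ℕ := min k.val (n - k.val)

/-- The character `χ_k(x) = exp (2πikx/n)` of `ℤ/nℤ`. -/
def cyclicChar (n : ℕ) (k x : ZMod n) : ℂ :=
  Complex.exp (2 * Real.pi * Complex.I * k.val * x.val / n)

/-- The normalized counting measure on `ℤ/nℤ`: every point has mass `1/n`. -/
def normalizedCount (n : ℕ) : Measure (ZMod n) := (n : ℝ≥0∞)⁻¹ • Measure.count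

/-- The `L_p` norm, for a real exponent `p`, with respect to the normalized counting measure. -/
def cyclicLpNorm (n : ℕ) (p : ℝ) (f : ZMod n → ℂ) : ℝ :=
  (eLpNorm f (ENNReal.ofReal p) (normalizedCount n)).toReal

/-- The Poisson-like semigroup on `ℤ/nℤ`: the Fourier multiplier with symbol `exp (-t ψ_n(k))`,
i.e. the linear map `∑ₖ aₖ χₖ ↦ ∑ₖ exp (-t ψ_n(k)) aₖ χₖ` (see `poissonSemigroup_sum`), where
`aₖ = (1/n) ∑ₓ f(x) χₖ(-x)` are the Fourier coefficients of `f`. -/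
def poissonSemigroup (n : ℕ) [NeZero n] (t : ℝ) : (ZMod n → ℂ) →ₗ[ℂ] (ZMod n → ℂ) where
  toFun f x := ∑ k : ZMod n,
    (Real.exp (-t * wordLength n k) : ℂ) *
      ((n : ℂ)⁻¹ * ∑ y : ZMod n, f y * cyclicChar n k (-y)) * cyclicChar n k x
  map_add' f g := by
    funext x
    simp only [Pi.add_apply, add_mul, mul_add, Finset.sum_add_distrib]
  map_smul' c f := by
    funext x
    simp only [Pi.smul_apply, smul_eq_mul, RingHom.id_apply, Finset.mul_sum, Finset.sum_mul]
    refine Finset.sum_congr rfl fun k _ => Finset.sum_congr rfl fun y _ => ?_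
    ring

theorem cyclicChar_eq_stdAddChar (n : ℕ) [NeZero n] (k x : ZMod n) :
    cyclicChar n k x = stdAddChar (k * x) := by
  have h : k * x = (((k.val * x.val : ℕ) : ℤ) : ZMod n) := by
    simp
  rw [h, stdAddChar_coe, cyclicChar]
  congr 1
  push_cast
  ring

/-- The defining action of the semigroup on Fourier series. -/
theorem poissonSemigroup_sum (n : ℕ) [NeZero n] (t : ℝ) (a : ZMod n → ℂ) :
    poissonSemigroup n t (fun x => ∑ k : ZMod n, a k * cyclicChar n k x) =
      fun x => ∑ k : ZMod n, (Real.exp (-t * wordLength n k) : ℂ) * a k * cyclicChar n k x := by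
  funext x
  change ∑ k : ZMod n, _ = _
  refine Finset.sum_congr rfl fun k _ => ?_
  congr 2
  simp only [cyclicChar_eq_stdAddChar, Finset.sum_mul]
  rw [Finset.sum_comm]
  have key : ∀ j : ZMod n, ∑ y : ZMod n, a j * stdAddChar (j * y) * stdAddChar (k * -y)
      = if j = k then (n : ℂ) * a k else 0 := by
    intro j
    have h1 : ∀ y : ZMod n, a j * stdAddChar (j * y) * stdAddChar (k * -y)
        = a j * stdAddChar (y * (j - k)) := by
      intro y
      rw [mul_assoc, ← AddChar.map_add_eq_mul]
      congr 2
      ring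
    simp only [h1]
    rw [← Finset.mul_sum, AddChar.sum_mulShift (j - k) (isPrimitive_stdAddChar n)]
    by_cases hjk : j = k
    · subst hjk
      simp [ZMod.card, mul_comm]
    · simp [hjk, sub_ne_zero.mpr hjk]
  simp only [key, Finset.sum_ite_eq', Finset.mem_univ, if_true]
  have hn : (n : ℂ) ≠ 0 := Nat.cast_ne_zero.mpr (NeZero.ne n)
  field_simp

/-- The `L_p` norm as an explicit normalized sum. -/
theorem cyclicLpNorm_eq (n : ℕ) [NeZero n] (p : ℝ) (hp : 0 < p) (f : ZMod n → ℂ) :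
    cyclicLpNorm n p f = ((n : ℝ)⁻¹ * ∑ x : ZMod n, ‖f x‖ ^ p) ^ (1 / p) := by
  have hn : (n : ℝ≥0∞)⁻¹ = ENNReal.ofReal ((n : ℝ)⁻¹) := by
    rw [ENNReal.ofReal_inv_of_pos (Nat.cast_pos.mpr (NeZero.pos n)), ENNReal.ofReal_natCast]
  have h0 : (0 : ℝ) ≤ ∑ x : ZMod n, ‖f x‖ ^ p :=
    Finset.sum_nonneg fun x _ => Real.rpow_nonneg (norm_nonneg _) _
  rw [cyclicLpNorm, normalizedCount,
    eLpNorm_eq_lintegral_rpow_enorm_toReal (by simpa using hp) ENNReal.ofReal_ne_top,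
    ENNReal.toReal_ofReal hp.le, lintegral_smul_measure, lintegral_count, tsum_fintype]
  have h1 : ∀ x : ZMod n, ‖f x‖ₑ ^ p = ENNReal.ofReal (‖f x‖ ^ p) := fun x => by
    rw [← ofReal_norm, ENNReal.ofReal_rpow_of_nonneg (norm_nonneg _) hp.le]
  simp only [h1]
  rw [← ENNReal.ofReal_sum_of_nonneg fun x _ => Real.rpow_nonneg (norm_nonneg _) _, smul_eq_mul,
    hn, ← ENNReal.ofReal_mul (by positivity),
    ENNReal.ofReal_rpow_of_nonneg (by positivity) (by positivity),
    ENNReal.toReal_ofReal (by positivity)]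

end

/-! Both families consist of even numbers `n = 2m`, and evenness is what the argument rests on.

Sufficiency follows Gross: a logarithmic Sobolev inequality Ent(f²) ≤ 2⟨f, Lf⟩ for the generator L
χ_k = ψ(k) χ_k (`logSobolev`), combined with the Stroock–Varopoulos comparison
(`dirichlet_rpow_le`), makes ‖P_t f‖_{q(t)} nonincreasing along q(t) = 1 + (p-1)e^{2t}. This is done
for positive f; positivity of the kernel of P_t then transfers it to complex f.

The logarithmic Sobolev inequality comes from replacing u² log u² by its cubic Taylor polynomial at
1, which dominates it. Writing f = M + g with g of mean zero, what remains is a bound on the cubic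
moment of g, that is, on Σ X_a X_b X_{a+b} with X_k = |ĝ(k)| (`cubic_sum_le`). Among three nonzero
residues of sum 0, two lie in the same open half of the cycle; restricting to such pairs and using 2
X_a X_b X_{a+b} ≤ X_{a+b}² + X_a² X_b² gives a first term governed by ψ, since c ≠ 0 is a sum of two
residues of one half in at most 2(ψ(c) - 1) ways, and a second term at most ½‖g‖₂⁴.

Necessity: for f = 1 + ε Re χ₁ both norms are 1 plus an explicit multiple of ε², and comparing these
gives (q-1)e^{-2t} ≤ p-1. -/

noncomputable section

/-! ### Fourier coefficients and inversion on ℤ/nℤ -/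

theorem sum_stdAddChar_mul (n : ℕ) [NeZero n] (a : ZMod n) :
    ∑ x : ZMod n, (stdAddChar (a * x) : ℂ) = if a = 0 then (n : ℂ) else 0 := by
  have h := AddChar.sum_mulShift a (isPrimitive_stdAddChar n)
  simp only [ZMod.card] at h
  simp only [mul_comm a, h]
  split_ifs <;> simp

/-- The Fourier coefficient of a function on `ℤ/nℤ`. -/
def cyclicCoeff (n : ℕ) [NeZero n] (f : ZMod n → ℂ) (k : ZMod n) : ℂ :=
  (n : ℂ)⁻¹ * ∑ y : ZMod n, f y * stdAddChar (-(k * y))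

theorem sum_cyclicCoeff_mul (n : ℕ) [NeZero n] (f : ZMod n → ℂ) (x : ZMod n) :
    ∑ k : ZMod n, cyclicCoeff n f k * stdAddChar (k * x) = f x := by
  have hn : (n : ℂ) ≠ 0 := Nat.cast_ne_zero.mpr (NeZero.ne n)
  have h1 : ∀ k : ZMod n, cyclicCoeff n f k * stdAddChar (k * x)
      = ∑ y : ZMod n, (n : ℂ)⁻¹ * f y * stdAddChar ((x - y) * k) := by
    intro k
    rw [cyclicCoeff, Finset.mul_sum, Finset.sum_mul]
    refine Finset.sum_congr rfl fun y _ => ?_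
    rw [show (x - y) * k = -(k * y) + k * x by ring, AddChar.map_add_eq_mul]
    ring
  simp only [h1]
  rw [Finset.sum_comm]
  simp only [← Finset.mul_sum, sum_stdAddChar_mul, sub_eq_zero]
  simp
  field_simp

theorem cyclicCoeff_conj (n : ℕ) [NeZero n] (f : ZMod n → ℝ) (k : ZMod n) :
    cyclicCoeff n (fun x => (f x : ℂ)) (-k)
      = (starRingEnd ℂ) (cyclicCoeff n (fun x => (f x : ℂ)) k) := by
  simp only [cyclicCoeff, map_mul, map_inv₀, map_natCast, map_sum, Complex.conj_ofReal]
  congr 1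
  refine Finset.sum_congr rfl fun y _ => ?_
  rw [← AddChar.map_neg_eq_conj]
  congr 2
  ring

theorem norm_cyclicCoeff_neg (n : ℕ) [NeZero n] (f : ZMod n → ℝ) (k : ZMod n) :
    ‖cyclicCoeff n (fun x => (f x : ℂ)) (-k)‖ = ‖cyclicCoeff n (fun x => (f x : ℂ)) k‖ := by
  rw [cyclicCoeff_conj, Complex.norm_conj]

theorem cyclicCoeff_zero (n : ℕ) [NeZero n] (f : ZMod n → ℂ) :
    cyclicCoeff n f 0 = (n : ℂ)⁻¹ * ∑ y : ZMod n, f y := by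
  simp [cyclicCoeff]

/-- The average of a product, in terms of Fourier coefficients. -/
theorem average_mul (n : ℕ) [NeZero n] (f : ZMod n → ℂ) (a : ZMod n → ℂ) :
    (n : ℂ)⁻¹ * ∑ x : ZMod n, f x * ∑ k : ZMod n, a k * stdAddChar (k * x)
      = ∑ k : ZMod n, cyclicCoeff n f (-k) * a k := by
  simp only [cyclicCoeff, Finset.mul_sum, Finset.sum_mul]
  rw [Finset.sum_comm]
  refine Finset.sum_congr rfl fun k _ => Finset.sum_congr rfl fun y _ => ?_
  rw [neg_mul, neg_neg]
  ring

theorem cyclicCoeff_sum (n : ℕ) [NeZero n] (a : ZMod n → ℂ) (j : ZMod n) :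
    cyclicCoeff n (fun x => ∑ k : ZMod n, a k * stdAddChar (k * x)) j = a j := by
  have hn : (n : ℂ) ≠ 0 := Nat.cast_ne_zero.mpr (NeZero.ne n)
  simp only [cyclicCoeff, Finset.sum_mul]
  rw [Finset.sum_comm]
  have h : ∀ k y : ZMod n, a k * stdAddChar (k * y) * stdAddChar (-(j * y))
      = a k * stdAddChar ((k - j) * y) := by
    intro k y
    rw [show (k - j) * y = k * y + -(j * y) by ring, AddChar.map_add_eq_mul]
    ring
  simp only [h, ← Finset.mul_sum, sum_stdAddChar_mul, sub_eq_zero]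
  simp
  field_simp

/-- The Fourier coefficients of a product are the convolution of the Fourier coefficients. -/
theorem cyclicCoeff_mul (n : ℕ) [NeZero n] (f g : ZMod n → ℂ) (j : ZMod n) :
    cyclicCoeff n (fun x => f x * g x) j
      = ∑ k : ZMod n, cyclicCoeff n f (j - k) * cyclicCoeff n g k := by
  have h1 : ∀ x, f x * g x = f x * ∑ k : ZMod n, cyclicCoeff n g k * stdAddChar (k * x) :=
    fun x => by rw [sum_cyclicCoeff_mul]
  simp only [h1]
  have h2 := average_mul n (fun x => f x * stdAddChar (-(j * x))) (cyclicCoeff n g)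
  rw [show (∑ k : ZMod n, cyclicCoeff n f (j - k) * cyclicCoeff n g k)
    = ∑ k : ZMod n, cyclicCoeff n (fun x => f x * stdAddChar (-(j * x))) (-k) *
      cyclicCoeff n g k from ?_, ← h2]
  · rw [cyclicCoeff]
    congr 1
    refine Finset.sum_congr rfl fun x _ => ?_
    ring
  · refine Finset.sum_congr rfl fun k _ => ?_
    congr 1
    simp only [cyclicCoeff]
    congr 1
    refine Finset.sum_congr rfl fun y _ => ?_
    rw [mul_assoc, ← AddChar.map_add_eq_mul]
    congr 2
    ring

/-! ### Even multipliers as real convolution kernels -/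

/-- The real convolution kernel of the Fourier multiplier with symbol `φ`. -/
def multiplierKernel (n : ℕ) [NeZero n] (φ : ZMod n → ℝ) (x : ZMod n) : ℝ :=
  (n : ℝ)⁻¹ * ∑ k : ZMod n, φ k * (stdAddChar (k * x) : ℂ).re

theorem ofReal_multiplierKernel (n : ℕ) [NeZero n] (φ : ZMod n → ℝ) (hφ : ∀ k, φ (-k) = φ k)
    (x : ZMod n) :
    (multiplierKernel n φ x : ℂ) = (n : ℂ)⁻¹ * ∑ k : ZMod n, φ k * stdAddChar (k * x) := by
  have him : ∑ k : ZMod n, φ k * (stdAddChar (k * x) : ℂ).im = 0 := by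
    have h : ∑ k : ZMod n, φ k * (stdAddChar (k * x) : ℂ).im
        = ∑ k : ZMod n, -(φ k * (stdAddChar (k * x) : ℂ).im) := by
      rw [← Equiv.sum_comp (Equiv.neg (ZMod n))]
      refine Finset.sum_congr rfl fun k _ => ?_
      simp only [Equiv.neg_apply, hφ, neg_mul, AddChar.map_neg_eq_conj, Complex.conj_im]
      ring
    rw [Finset.sum_neg_distrib] at h
    linarith
  have h : ∑ k : ZMod n, (φ k : ℂ) * stdAddChar (k * x)
      = ((∑ k : ZMod n, φ k * (stdAddChar (k * x) : ℂ).re : ℝ) : ℂ) := by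
    apply Complex.ext
    · simp
    · simpa using him
  rw [h, multiplierKernel]
  push_cast
  rfl

theorem multiplierKernel_neg (n : ℕ) [NeZero n] (φ : ZMod n → ℝ) (x : ZMod n) :
    multiplierKernel n φ (-x) = multiplierKernel n φ x := by
  simp [multiplierKernel, AddChar.map_neg_eq_conj]

theorem sum_multiplierKernel (n : ℕ) [NeZero n] (φ : ZMod n → ℝ) :
    ∑ x : ZMod n, multiplierKernel n φ x = φ 0 := by
  have hn : (n : ℝ) ≠ 0 := Nat.cast_ne_zero.mpr (NeZero.ne n)
  have h : ∀ k : ZMod n, ∑ x : ZMod n, (stdAddChar (k * x) : ℂ).re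
      = if k = 0 then (n : ℝ) else 0 := by
    intro k
    rw [← Complex.re_sum, sum_stdAddChar_mul]
    split_ifs <;> simp
  simp only [multiplierKernel, ← Finset.mul_sum]
  rw [Finset.sum_comm]
  simp only [← Finset.mul_sum, h]
  simp
  field_simp

theorem multiplier_eq_convolution (n : ℕ) [NeZero n] (φ : ZMod n → ℝ) (hφ : ∀ k, φ (-k) = φ k)
    (f : ZMod n → ℂ) (x : ZMod n) :
    ∑ k : ZMod n, (φ k : ℂ) * cyclicCoeff n f k * stdAddChar (k * x)
      = ∑ y : ZMod n, (multiplierKernel n φ (x - y) : ℂ) * f y := by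
  simp only [ofReal_multiplierKernel n φ hφ, cyclicCoeff, Finset.mul_sum, Finset.sum_mul]
  rw [Finset.sum_comm]
  refine Finset.sum_congr rfl fun y _ => Finset.sum_congr rfl fun k _ => ?_
  rw [show k * (x - y) = k * x + -(k * y) by ring, AddChar.map_add_eq_mul]
  ring

theorem wordLength_neg (n : ℕ) [NeZero n] (k : ZMod n) : wordLength n (-k) = wordLength n k := by
  have hk := ZMod.val_lt k
  rw [wordLength, wordLength, ZMod.neg_val]
  split_ifs with h
  · simp [h]
  · omega

theorem poissonSemigroup_apply (n : ℕ) [NeZero n] (t : ℝ) (f : ZMod n → ℂ) (x : ZMod n) :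
    poissonSemigroup n t f x = ∑ k : ZMod n,
      (Real.exp (-t * wordLength n k) : ℂ) * cyclicCoeff n f k * stdAddChar (k * x) := by
  change ∑ k : ZMod n, _ = _
  refine Finset.sum_congr rfl fun k _ => ?_
  simp only [cyclicChar_eq_stdAddChar, cyclicCoeff, mul_neg]

theorem poissonSemigroup_eq_convolution (n : ℕ) [NeZero n] (t : ℝ) (f : ZMod n → ℂ)
    (x : ZMod n) :
    poissonSemigroup n t f x = ∑ y : ZMod n,
      (multiplierKernel n (fun k => Real.exp (-t * wordLength n k)) (x - y) : ℂ) * f y := by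
  rw [poissonSemigroup_apply, ← multiplier_eq_convolution]
  intro k
  rw [wordLength_neg]

/-! ### Signs of the kernels of P_t and of its generator -/

/-- Second differences of the symbol correspond to multiplying the kernel by `|1 - r χ₁(x)|²`. -/
theorem multiplierKernel_second_difference (n : ℕ) [NeZero n] (φ : ZMod n → ℝ) (r : ℝ)
    (hφ : ∀ k, φ (-k) = φ k) (x : ZMod n) :
    multiplierKernel n (fun k => (1 + r ^ 2) * φ k - r * φ (k - 1) - r * φ (k + 1)) x
      = (1 + r ^ 2 - 2 * r * (stdAddChar x : ℂ).re) * multiplierKernel n φ x := by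
  have h1 : ∑ k : ZMod n, (φ (k - 1) : ℂ) * stdAddChar (k * x)
      = stdAddChar x * ∑ k : ZMod n, (φ k : ℂ) * stdAddChar (k * x) := by
    rw [← Equiv.sum_comp (Equiv.addRight (1 : ZMod n)), Finset.mul_sum]
    refine Finset.sum_congr rfl fun k _ => ?_
    simp only [Equiv.coe_addRight, add_sub_cancel_right, add_mul, one_mul, AddChar.map_add_eq_mul]
    ring
  have h2 : ∑ k : ZMod n, (φ (k + 1) : ℂ) * stdAddChar (k * x)
      = stdAddChar (-x) * ∑ k : ZMod n, (φ k : ℂ) * stdAddChar (k * x) := by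
    rw [← Equiv.sum_comp (Equiv.subRight (1 : ZMod n)), Finset.mul_sum]
    refine Finset.sum_congr rfl fun k _ => ?_
    simp only [Equiv.subRight_apply, sub_add_cancel]
    rw [show (k - 1) * x = k * x + -x by ring, AddChar.map_add_eq_mul]
    ring
  have h3 : (stdAddChar x : ℂ) + stdAddChar (-x) = ((2 * (stdAddChar x : ℂ).re : ℝ) : ℂ) := by
    rw [AddChar.map_neg_eq_conj, Complex.add_conj]
  have hev : ∀ k : ZMod n, (1 + r ^ 2) * φ (-k) - r * φ (-k - 1) - r * φ (-k + 1)
      = (1 + r ^ 2) * φ k - r * φ (k - 1) - r * φ (k + 1) := by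
    intro k
    rw [hφ, show -k - 1 = -(k + 1) by ring, show -k + 1 = -(k - 1) by ring, hφ, hφ]
    ring
  apply Complex.ofReal_injective
  rw [Complex.ofReal_mul, ofReal_multiplierKernel n _ hev, ofReal_multiplierKernel n φ hφ]
  have h4 : ∑ k : ZMod n, (((1 + r ^ 2) * φ k - r * φ (k - 1) - r * φ (k + 1) : ℝ) : ℂ)
        * stdAddChar (k * x)
      = (1 + (r : ℂ) ^ 2 - r * (stdAddChar x + stdAddChar (-x)))
        * ∑ k : ZMod n, (φ k : ℂ) * stdAddChar (k * x) := by
    rw [sub_mul, mul_assoc, add_mul (stdAddChar x : ℂ), ← h1, ← h2, Finset.mul_sum,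
      ← Finset.sum_add_distrib, Finset.mul_sum, ← Finset.sum_sub_distrib]
    refine Finset.sum_congr rfl fun k _ => ?_
    push_cast
    ring
  rw [h4, h3]
  push_cast
  ring

theorem wordLength_add_one {n m : ℕ} [NeZero n] (hm : n = 2 * m) (k : ZMod n) :
    wordLength n (k + 1) = if k.val < m then wordLength n k + 1 else wordLength n k - 1 := by
  have hk := ZMod.val_lt k
  have h0 := NeZero.pos n
  have h1 : (k + 1).val = if k.val + 1 = n then 0 else k.val + 1 := by
    have : Fact (1 < n) := ⟨by omega⟩
    rw [ZMod.val_add, ZMod.val_one]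
    split_ifs with h
    · rw [h, Nat.mod_self]
    · exact Nat.mod_eq_of_lt (by omega)
  rw [wordLength, wordLength, h1]
  split_ifs <;> omega

theorem wordLength_sub_one {n m : ℕ} [NeZero n] (hm : n = 2 * m) (k : ZMod n) :
    wordLength n (k - 1)
      = if k.val = 0 ∨ m < k.val then wordLength n k + 1 else wordLength n k - 1 := by
  rw [← wordLength_neg, show -(k - 1) = -k + 1 by ring, wordLength_add_one hm, wordLength_neg]
  have hk := ZMod.val_lt k
  rw [ZMod.neg_val]
  have : k = 0 ↔ k.val = 0 := (ZMod.val_eq_zero k).symm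
  simp only [this]
  split_ifs <;> omega

theorem val_natCast_half {n m : ℕ} [NeZero n] (hm : n = 2 * m) : ((m : ℕ) : ZMod n).val = m := by
  have h0 := NeZero.pos n
  exact ZMod.val_cast_of_lt (by omega)

/-- If the second difference of `φ` is `A` at `0`, `-B` at `n / 2` and zero elsewhere, with
`|B| ≤ A`, the kernel is nonnegative up to the factor `|1 - r χ₁|²`. -/
theorem kernel_nonneg_of_second_difference {n m : ℕ} [NeZero n] (φ : ZMod n → ℝ)
    (hφ : ∀ k, φ (-k) = φ k) (r A B : ℝ) (hB : 0 ≤ B) (hAB : B ≤ A)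
    (h : ∀ k, (1 + r ^ 2) * φ k - r * φ (k - 1) - r * φ (k + 1)
      = (if k = 0 then A else 0) - (if k = (m : ZMod n) then B else 0)) (x : ZMod n) :
    0 ≤ (1 + r ^ 2 - 2 * r * (stdAddChar x : ℂ).re) * multiplierKernel n φ x := by
  rw [← multiplierKernel_second_difference n φ r hφ, multiplierKernel]
  refine mul_nonneg (by positivity) ?_
  simp only [h, sub_mul, ite_mul, zero_mul, Finset.sum_sub_distrib, Finset.sum_ite_eq',
    Finset.mem_univ, if_true]
  have h1 : (stdAddChar ((m : ZMod n) * x) : ℂ).re ≤ 1 := by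
    refine (Complex.re_le_norm _).trans ?_
    rw [AddChar.norm_apply]
  simp only [AddChar.map_zero_eq_one, Complex.one_re]
  nlinarith

/-- With r = e^{-t}, the sequence r^ψ is geometric on each half of the cycle, so its second
difference vanishes except at the two corners 0 and m, where it equals 1 - r² and -r^m(1 - r²). For
r < 1 the factor |1 - rχ₁|² is positive and can be divided out. -/
theorem multiplierKernel_exp_nonneg {n m : ℕ} [NeZero n] (hm : n = 2 * m) {t : ℝ} (ht : 0 ≤ t)
    (x : ZMod n) :
    0 ≤ multiplierKernel n (fun k => Real.exp (-t * wordLength n k)) x := by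
  rcases ht.eq_or_lt with rfl | ht
  · have h : ∑ k : ZMod n, (stdAddChar (k * x) : ℂ).re = if x = 0 then (n : ℝ) else 0 := by
      simp only [mul_comm _ x]
      rw [← Complex.re_sum, sum_stdAddChar_mul]
      split_ifs <;> simp
    simp only [multiplierKernel, neg_zero, zero_mul, Real.exp_zero, one_mul, h]
    positivity
  · set r := Real.exp (-t) with hr
    have hr0 : 0 < r := Real.exp_pos _
    have hr1 : r < 1 := by rw [hr, Real.exp_lt_one_iff]; linarith
    have he : ∀ k, Real.exp (-t * wordLength n k) = r ^ wordLength n k := by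
      intro k; rw [hr, ← Real.exp_nat_mul, mul_comm]
    simp only [he]
    have key := kernel_nonneg_of_second_difference (m := m) (fun k => r ^ wordLength n k)
      (fun k => by simp only [wordLength_neg]) r (1 - r ^ 2) (r ^ m * (1 - r ^ 2))
      (mul_nonneg (by positivity) (by nlinarith))
      (mul_le_of_le_one_left (by nlinarith) (pow_le_one₀ hr0.le hr1.le)) (fun k => ?_) x
    · refine nonneg_of_mul_nonneg_right key ?_
      have h1 : (stdAddChar x : ℂ).re ≤ 1 := by
        refine (Complex.re_le_norm _).trans ?_
        rw [AddChar.norm_apply]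
      nlinarith [sq_nonneg (1 - r), mul_pos (sub_pos.2 hr1) (sub_pos.2 hr1)]
    · have hk := ZMod.val_lt k
      have h0 := NeZero.pos n
      have e0 : k = 0 ↔ k.val = 0 := (ZMod.val_eq_zero k).symm
      have em : k = (m : ZMod n) ↔ k.val = m := by
        rw [← (ZMod.val_injective n).eq_iff, val_natCast_half hm]
      simp only [wordLength_add_one hm, wordLength_sub_one hm, e0, em]
      have hw : wordLength n k = if k.val ≤ m then k.val else n - k.val := by
        rw [wordLength]; split_ifs <;> omega
      rcases lt_trichotomy k.val m with hlt | heq | hgt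
      · by_cases hz : k.val = 0
        · have : m ≠ 0 := by omega
          rw [hw]
          simp [hz, Ne.symm this, show 0 < m by omega]
          ring
        · have : ¬ m < k.val := by omega
          simp only [hz, this, hlt, if_true, if_false, or_self, hlt.ne]
          obtain ⟨j, hj⟩ : ∃ j, wordLength n k = j + 1 := ⟨wordLength n k - 1, by
            rw [hw, if_pos hlt.le]; omega⟩
          rw [hj, Nat.add_sub_cancel]
          ring
      · have h1 : k.val ≠ 0 := by omega
        have h2 : m ≠ 0 := by omega
        obtain ⟨j, hj⟩ : ∃ j, m = j + 1 := ⟨m - 1, by omega⟩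
        rw [hw]
        simp [heq, h2]
        rw [hj, Nat.add_sub_cancel]
        ring
      · have h1 : k.val ≠ 0 := by omega
        have h2 : ¬ k.val < m := by omega
        simp only [h1, hgt, h2, hgt.ne', if_true, if_false, or_true]
        obtain ⟨j, hj⟩ : ∃ j, wordLength n k = j + 1 := ⟨wordLength n k - 1, by
            rw [hw, if_neg (by omega)]; omega⟩
        rw [hj, Nat.add_sub_cancel]
        ring

/-- The case r = 1 of the same argument, applied to -ψ, which is linear on each half with corners
±2. The factor |1 - χ₁(x)|² is positive exactly for x ≠ 0. This sign makes the quadratic form of the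
generator a Dirichlet form. -/
theorem multiplierKernel_wordLength_nonpos {n m : ℕ} [NeZero n] (hm : n = 2 * m) {x : ZMod n}
    (hx : x ≠ 0) : multiplierKernel n (fun k => (wordLength n k : ℝ)) x ≤ 0 := by
  have key := kernel_nonneg_of_second_difference (m := m) (fun k => -(wordLength n k : ℝ))
      (fun k => by simp only [wordLength_neg]) 1 2 2 (by norm_num) le_rfl (fun k => ?_) x
  · have h1 : (stdAddChar x : ℂ).re < 1 := by
      refine lt_of_le_of_ne ((Complex.re_le_norm _).trans (by rw [AddChar.norm_apply])) fun h => hx ?_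
      have hn : Complex.normSq (stdAddChar x : ℂ) = 1 := by
        rw [Complex.normSq_eq_norm_sq, AddChar.norm_apply, one_pow]
      rw [Complex.normSq_apply, h] at hn
      have him : (stdAddChar x : ℂ).im = 0 := by nlinarith
      apply ZMod.injective_stdAddChar
      rw [AddChar.map_zero_eq_one]
      exact Complex.ext h him
    have h2 := nonneg_of_mul_nonneg_right key (by linarith)
    have h3 : multiplierKernel n (fun k => -(wordLength n k : ℝ)) x
        = -multiplierKernel n (fun k => (wordLength n k : ℝ)) x := by
      simp [multiplierKernel]
    linarith
  · have hk := ZMod.val_lt k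
    have h0 := NeZero.pos n
    have e0 : k = 0 ↔ k.val = 0 := (ZMod.val_eq_zero k).symm
    have em : k = (m : ZMod n) ↔ k.val = m := by
      rw [← (ZMod.val_injective n).eq_iff, val_natCast_half hm]
    simp only [wordLength_add_one hm, wordLength_sub_one hm, e0, em]
    have hw : wordLength n k = if k.val ≤ m then k.val else n - k.val := by
      rw [wordLength]; split_ifs <;> omega
    -- Ensures that the natural subtraction in the neighbour formulas is a genuine one.
    have hpos : k.val ≠ 0 → 1 ≤ wordLength n k := by
      intro h; rw [hw]; split_ifs <;> omega
    rcases lt_trichotomy k.val m with hlt | heq | hgt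
    · by_cases hz : k.val = 0
      · have : m ≠ 0 := by omega
        rw [hw]
        simp [hz, Ne.symm this, show 0 < m by omega]
        norm_num
      · have : ¬ m < k.val := by omega
        simp only [hz, this, hlt, if_true, if_false, or_self, hlt.ne]
        rw [Nat.cast_sub (hpos hz)]
        push_cast
        ring
    · have h1 : k.val ≠ 0 := by omega
      have h2 : m ≠ 0 := by omega
      simp only [heq, h2, lt_irrefl, or_self, if_true, if_false]
      rw [Nat.cast_sub (hpos h1)]
      push_cast
      ring
    · have h1 : k.val ≠ 0 := by omega
      have h2 : ¬ k.val < m := by omega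
      simp only [h1, hgt, h2, hgt.ne', if_true, if_false, or_true]
      rw [Nat.cast_sub (hpos h1)]
      push_cast
      ring

/-! ### Pairs in one half of the cycle and the cubic inequality -/

/-- Two residues lie in the same open half of `ℤ/nℤ`, `n = 2m`. -/
def SameHalf {n : ℕ} (m : ℕ) (a b : ZMod n) : Prop :=
  (0 < a.val ∧ a.val < m ∧ 0 < b.val ∧ b.val < m) ∨ (m < a.val ∧ m < b.val)

open Classical in
/-- The indicator function of `SameHalf`. -/
def halfInd {n : ℕ} (m : ℕ) (a b : ZMod n) : ℝ := if SameHalf m a b then 1 else 0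

theorem halfInd_nonneg {n : ℕ} (m : ℕ) (a b : ZMod n) : 0 ≤ halfInd m a b := by
  unfold halfInd; split_ifs <;> norm_num

theorem val_add_cases {n : ℕ} [NeZero n] (a b : ZMod n) :
    ((a + b).val = a.val + b.val ∧ a.val + b.val < n) ∨
      ((a + b).val + n = a.val + b.val ∧ n ≤ a.val + b.val) := by
  have ha := ZMod.val_lt a
  have hb := ZMod.val_lt b
  rcases lt_or_ge (a.val + b.val) n with h | h
  · exact .inl ⟨ZMod.val_add_of_lt h, h⟩
  · exact .inr ⟨(ZMod.val_add_val_of_le h).symm, h⟩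

/-- Pigeonhole on the two open halves, for a, b and -(a + b). If one of the three is m, the other
two add up to m modulo n, which again forces them into a common half. -/
theorem one_le_halfInd {n m : ℕ} [NeZero n] (hm : n = 2 * m) {a b : ZMod n} (ha : a ≠ 0)
    (hb : b ≠ 0) (hab : a + b ≠ 0) :
    1 ≤ halfInd m a b + halfInd m b (-(a + b)) + halfInd m (-(a + b)) a := by
  have key : SameHalf m a b ∨ SameHalf m b (-(a + b)) ∨ SameHalf m (-(a + b)) a := by
    have h1 := ZMod.val_lt a
    have h2 := ZMod.val_lt b
    have h3 := val_add_cases a b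
    have ha' : a.val ≠ 0 := fun h => ha ((ZMod.val_eq_zero a).1 h)
    have hb' : b.val ≠ 0 := fun h => hb ((ZMod.val_eq_zero b).1 h)
    have hc' : (a + b).val ≠ 0 := fun h => hab ((ZMod.val_eq_zero _).1 h)
    have h4 : (-(a + b)).val = n - (a + b).val := by rw [ZMod.neg_val, if_neg hab]
    unfold SameHalf
    rw [h4]
    omega
  have n1 := halfInd_nonneg m a b
  have n2 := halfInd_nonneg m b (-(a + b))
  have n3 := halfInd_nonneg m (-(a + b)) a
  rcases key with h | h | h
  · have : halfInd m a b = 1 := if_pos h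
    linarith
  · have : halfInd m b (-(a + b)) = 1 := if_pos h
    linarith
  · have : halfInd m (-(a + b)) a = 1 := if_pos h
    linarith

theorem sum_halfInd_le {n m : ℕ} [NeZero n] (hm : n = 2 * m) {c : ZMod n} (hc : c ≠ 0) :
    ∑ a : ZMod n, halfInd m a (c - a) ≤ 2 * ((wordLength n c : ℝ) - 1) := by
  classical
  have hc' : c.val ≠ 0 := fun h => hc ((ZMod.val_eq_zero c).1 h)
  have hcn := ZMod.val_lt c
  have hw : 1 ≤ wordLength n c := by rw [wordLength]; omega
  have h1 : ∑ a : ZMod n, halfInd m a (c - a)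
      = ((Finset.univ.filter fun a : ZMod n => SameHalf m a (c - a)).card : ℝ) := by
    simp only [halfInd, Finset.sum_boole]
  set l := wordLength n c with hl
  -- Two residues of the lower half add up to c without carry, two of the upper half with a carry of
  -- n. Each case leaves an interval of ψ(c) - 1 values of a.
  have h2 : (Finset.univ.filter fun a : ZMod n => SameHalf m a (c - a)).card
      ≤ 2 * (l - 1) := by
    have hcard : (Finset.univ.filter fun a : ZMod n => SameHalf m a (c - a)).card
        ≤ ((if c.val ≤ m then Finset.Ico 1 c.val else Finset.Ioo (c.val - m) m) ∪
          (if c.val ≤ m then Finset.Ioo m (m + c.val) else Finset.Ioo c.val n)).card := by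
      refine Finset.card_le_card_of_injOn ZMod.val (fun a ha => ?_)
        (ZMod.val_injective n).injOn
      have ha := (Finset.mem_filter.1 ha).2
      have h3 := val_add_cases a (c - a)
      rw [add_sub_cancel] at h3
      have h4 := ZMod.val_lt (c - a)
      have h5 := ZMod.val_lt a
      unfold SameHalf at ha
      simp only [Finset.coe_union, Set.mem_union, Finset.mem_coe]
      split_ifs with h6
      · simp only [Finset.mem_Ico, Finset.mem_Ioo]; omega
      · simp only [Finset.mem_Ioo]; omega
    refine hcard.trans ((Finset.card_union_le _ _).trans ?_)
    rw [hl, wordLength]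
    split_ifs with h6
    · simp only [Nat.card_Ico, Nat.card_Ioo]; omega
    · simp only [Nat.card_Ioo]; omega
  rw [h1]
  calc _ ≤ ((2 * (l - 1) : ℕ) : ℝ) := by exact_mod_cast h2
    _ = _ := by push_cast [Nat.cast_sub hw]; ring

/-- For given a, at most one of b and -b shares its half, and Y is even; this is the source of the
factor 1/2. -/
theorem sum_halfInd_mul_le {n m : ℕ} [NeZero n] (hm : n = 2 * m) (Y : ZMod n → ℝ)
    (hY : ∀ k, 0 ≤ Y k) (hev : ∀ k, Y (-k) = Y k) :
    ∑ a : ZMod n, ∑ b : ZMod n, halfInd m a b * (Y a * Y b) ≤ 1 / 2 * (∑ k, Y k) ^ 2 := by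
  have h0 := NeZero.pos n
  have h1 : ∀ a b : ZMod n, halfInd m a b + halfInd m a (-b) ≤ 1 := by
    intro a b
    unfold halfInd
    have hb := ZMod.val_lt b
    have : ¬ (SameHalf m a b ∧ SameHalf m a (-b)) := by
      unfold SameHalf
      rw [ZMod.neg_val]
      split_ifs <;> omega
    split_ifs with h2 h3
    · exact absurd ⟨h2, h3⟩ this
    all_goals norm_num
  have h2 : ∑ a : ZMod n, ∑ b : ZMod n, halfInd m a b * (Y a * Y b)
      = ∑ a : ZMod n, ∑ b : ZMod n, halfInd m a (-b) * (Y a * Y b) := by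
    refine Finset.sum_congr rfl fun a _ => ?_
    rw [← Equiv.sum_comp (Equiv.neg (ZMod n))]
    simp only [Equiv.neg_apply, hev]
  have h3 : ∑ a : ZMod n, ∑ b : ZMod n, halfInd m a b * (Y a * Y b)
      + ∑ a : ZMod n, ∑ b : ZMod n, halfInd m a (-b) * (Y a * Y b) ≤ (∑ k, Y k) ^ 2 := by
    rw [sq, Finset.sum_mul_sum, ← Finset.sum_add_distrib]
    refine Finset.sum_le_sum fun a _ => ?_
    rw [← Finset.sum_add_distrib]
    refine Finset.sum_le_sum fun b _ => ?_
    nlinarith [h1 a b, mul_nonneg (hY a) (hY b)]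
  linarith

/-- The cubic inequality for Fourier coefficients underlying the logarithmic Sobolev inequality. -/
theorem cubic_sum_le {n m : ℕ} [NeZero n] (hm : n = 2 * m) (X : ZMod n → ℝ)
    (hX : ∀ k, 0 ≤ X k) (hev : ∀ k, X (-k) = X k) (hX0 : X 0 = 0) :
    2 / 3 * ∑ a : ZMod n, ∑ b : ZMod n, X a * X b * X (-(a + b))
      ≤ 2 * ∑ k : ZMod n, ((wordLength n k : ℝ) - 1) * X k ^ 2
        + 1 / 2 * (∑ k : ZMod n, X k ^ 2) ^ 2 := by
  set T := fun a b : ZMod n => X a * X b * X (-(a + b)) with hT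
  -- T is invariant under cyclic rotation of (a, b, -(a + b)), so the three choices of the pair in a
  -- common half contribute equally.
  have e1 : ∑ a : ZMod n, ∑ b : ZMod n, halfInd m b (-(a + b)) * T a b
      = ∑ a : ZMod n, ∑ b : ZMod n, halfInd m a b * T a b := by
    rw [Finset.sum_comm]
    refine Finset.sum_congr rfl fun b _ => ?_
    rw [← Equiv.sum_comp ((Equiv.neg (ZMod n)).trans (Equiv.subRight b))]
    refine Finset.sum_congr rfl fun c _ => ?_
    simp only [Equiv.trans_apply, Equiv.neg_apply, Equiv.subRight_apply, hT]
    rw [show -(-c - b + b) = c by ring, show -c - b = -(b + c) by ring]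
    ring
  have e2 : ∑ a : ZMod n, ∑ b : ZMod n, halfInd m (-(a + b)) a * T a b
      = ∑ a : ZMod n, ∑ b : ZMod n, halfInd m a b * T a b := by
    rw [Finset.sum_comm (f := fun a b => halfInd m a b * T a b)]
    refine Finset.sum_congr rfl fun a _ => ?_
    rw [← Equiv.sum_comp ((Equiv.neg (ZMod n)).trans (Equiv.subRight a))]
    refine Finset.sum_congr rfl fun c _ => ?_
    simp only [Equiv.trans_apply, Equiv.neg_apply, Equiv.subRight_apply, hT]
    rw [show -(a + (-c - a)) = c by ring, show -c - a = -(c + a) by ring]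
    ring
  have h1 : ∑ a : ZMod n, ∑ b : ZMod n, T a b
      ≤ 3 * ∑ a : ZMod n, ∑ b : ZMod n, halfInd m a b * T a b := by
    have : ∑ a : ZMod n, ∑ b : ZMod n, T a b
        ≤ ∑ a : ZMod n, ∑ b : ZMod n, halfInd m a b * T a b
          + ∑ a : ZMod n, ∑ b : ZMod n, halfInd m b (-(a + b)) * T a b
          + ∑ a : ZMod n, ∑ b : ZMod n, halfInd m (-(a + b)) a * T a b := by
      simp only [← Finset.sum_add_distrib]
      refine Finset.sum_le_sum fun a _ => Finset.sum_le_sum fun b _ => ?_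
      rw [← add_mul, ← add_mul]
      by_cases ha : a = 0
      · simp [hT, ha, hX0]
      by_cases hb : b = 0
      · simp [hT, hb, hX0]
      by_cases hab : a + b = 0
      · simp only [hT, hab, neg_zero, hX0, mul_zero, le_refl]
      have : 0 ≤ T a b := mul_nonneg (mul_nonneg (hX _) (hX _)) (hX _)
      nlinarith [one_le_halfInd hm ha hb hab]
    rw [e1, e2] at this
    linarith
  -- The square (X_{a+b} - X_a X_b)² ≥ 0, weighted by the indicator.
  have h2 : 2 * ∑ a : ZMod n, ∑ b : ZMod n, halfInd m a b * T a b
      ≤ ∑ a : ZMod n, ∑ b : ZMod n, halfInd m a b * X (a + b) ^ 2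
        + ∑ a : ZMod n, ∑ b : ZMod n, halfInd m a b * (X a ^ 2 * X b ^ 2) := by
    simp only [← Finset.sum_add_distrib, Finset.mul_sum]
    refine Finset.sum_le_sum fun a _ => Finset.sum_le_sum fun b _ => ?_
    simp only [hT, hev]
    nlinarith [mul_nonneg (halfInd_nonneg m a b) (sq_nonneg (X (a + b) - X a * X b))]
  have h3 : ∑ a : ZMod n, ∑ b : ZMod n, halfInd m a b * X (a + b) ^ 2
      ≤ 2 * ∑ k : ZMod n, ((wordLength n k : ℝ) - 1) * X k ^ 2 := by
    have : ∑ a : ZMod n, ∑ b : ZMod n, halfInd m a b * X (a + b) ^ 2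
        = ∑ c : ZMod n, (∑ a : ZMod n, halfInd m a (c - a)) * X c ^ 2 := by
      simp only [Finset.sum_mul]
      rw [Finset.sum_comm (f := fun c a => halfInd m a (c - a) * X c ^ 2)]
      refine Finset.sum_congr rfl fun a _ => ?_
      rw [← Equiv.sum_comp (Equiv.subRight a)]
      simp
    rw [this, Finset.mul_sum]
    refine Finset.sum_le_sum fun c _ => ?_
    by_cases hc : c = 0
    · simp [hc, hX0]
    rw [← mul_assoc]
    exact mul_le_mul_of_nonneg_right (sum_halfInd_le hm hc) (sq_nonneg _)
  have h4 := sum_halfInd_mul_le hm (fun k => X k ^ 2) (fun k => sq_nonneg _)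
    (fun k => by simp only [hev])
  linarith

/-! ### The generator, its Dirichlet form, and moments in Fourier terms -/

/-- The generator of the Poisson-like semigroup, acting on real functions. -/
def cyclicGen (n : ℕ) [NeZero n] (f : ZMod n → ℝ) (x : ZMod n) : ℝ :=
  ∑ y : ZMod n, multiplierKernel n (fun k => (wordLength n k : ℝ)) (x - y) * f y

theorem wordLength_zero (n : ℕ) : wordLength n 0 = 0 := by
  cases n <;> simp [wordLength]

theorem sum_wordLength_kernel_sub (n : ℕ) [NeZero n] (x : ZMod n) :
    ∑ y : ZMod n, multiplierKernel n (fun k => (wordLength n k : ℝ)) (x - y) = 0 := by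
  refine (Equiv.sum_comp (Equiv.subLeft x)
    (multiplierKernel n fun k => (wordLength n k : ℝ))).trans ?_
  rw [sum_multiplierKernel, wordLength_zero, Nat.cast_zero]

/-- The kernel is even and has total mass ψ(0) = 0, so the form can be symmetrized into products of
differences. -/
theorem sum_mul_cyclicGen (n : ℕ) [NeZero n] (f g : ZMod n → ℝ) :
    ∑ x : ZMod n, f x * cyclicGen n g x
      = 1 / 2 * ∑ x : ZMod n, ∑ y : ZMod n,
        -multiplierKernel n (fun k => (wordLength n k : ℝ)) (x - y)
          * ((f x - f y) * (g x - g y)) := by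
  set l := multiplierKernel n (fun k => (wordLength n k : ℝ)) with hl
  have hsym : ∀ x y, l (x - y) = l (y - x) := fun x y => by
    rw [← neg_sub, hl, multiplierKernel_neg]
  have h1 : ∑ x : ZMod n, f x * cyclicGen n g x
      = ∑ x : ZMod n, ∑ y : ZMod n, -(l (x - y) * (f x * (g x - g y))) := by
    refine Finset.sum_congr rfl fun x _ => ?_
    have : ∑ y : ZMod n, -(l (x - y) * (f x * (g x - g y)))
        = f x * ∑ y : ZMod n, l (x - y) * g y - f x * g x * ∑ y : ZMod n, l (x - y) := by
      rw [Finset.mul_sum, Finset.mul_sum, ← Finset.sum_sub_distrib]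
      exact Finset.sum_congr rfl fun y _ => by ring
    rw [this, sum_wordLength_kernel_sub, mul_zero, sub_zero, cyclicGen]
  have h2 : ∑ x : ZMod n, f x * cyclicGen n g x
      = ∑ x : ZMod n, ∑ y : ZMod n, -(l (x - y) * (f y * (g y - g x))) := by
    rw [h1, Finset.sum_comm]
    exact Finset.sum_congr rfl fun x _ => Finset.sum_congr rfl fun y _ => by rw [hsym]
  have h3 : ∑ x : ZMod n, f x * cyclicGen n g x + ∑ x : ZMod n, f x * cyclicGen n g x
      = ∑ x : ZMod n, ∑ y : ZMod n, -l (x - y) * ((f x - f y) * (g x - g y)) := by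
    nth_rewrite 1 [h1]
    rw [h2]
    simp only [← Finset.sum_add_distrib]
    exact Finset.sum_congr rfl fun x _ => Finset.sum_congr rfl fun y _ => by ring
  linarith

theorem ofReal_cyclicGen (n : ℕ) [NeZero n] (f : ZMod n → ℝ) (x : ZMod n) :
    (cyclicGen n f x : ℂ) = ∑ k : ZMod n,
      (wordLength n k : ℂ) * cyclicCoeff n (fun x => (f x : ℂ)) k * stdAddChar (k * x) := by
  have h := multiplier_eq_convolution n (fun k => (wordLength n k : ℝ))
    (fun k => by simp only [wordLength_neg]) (fun x => (f x : ℂ)) x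
  simp only [Complex.ofReal_natCast] at h
  rw [h, cyclicGen]
  push_cast
  rfl

theorem average_sq (n : ℕ) [NeZero n] (f : ZMod n → ℝ) :
    (n : ℝ)⁻¹ * ∑ x : ZMod n, f x ^ 2
      = ∑ k : ZMod n, ‖cyclicCoeff n (fun x => (f x : ℂ)) k‖ ^ 2 := by
  have h := average_mul n (fun x => (f x : ℂ)) (cyclicCoeff n fun x => (f x : ℂ))
  simp only [sum_cyclicCoeff_mul, cyclicCoeff_conj, ← Complex.normSq_eq_conj_mul_self,
    Complex.normSq_eq_norm_sq] at h
  apply Complex.ofReal_injective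
  push_cast at h ⊢
  rw [← h]
  simp only [sq]

theorem average_mul_cyclicGen (n : ℕ) [NeZero n] (f : ZMod n → ℝ) :
    (n : ℝ)⁻¹ * ∑ x : ZMod n, f x * cyclicGen n f x
      = ∑ k : ZMod n, (wordLength n k : ℝ) * ‖cyclicCoeff n (fun x => (f x : ℂ)) k‖ ^ 2 := by
  have h := average_mul n (fun x => (f x : ℂ))
    (fun k => (wordLength n k : ℂ) * cyclicCoeff n (fun x => (f x : ℂ)) k)
  simp only [← ofReal_cyclicGen, cyclicCoeff_conj, mul_left_comm _ (wordLength n _ : ℂ),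
    ← Complex.normSq_eq_conj_mul_self, Complex.normSq_eq_norm_sq] at h
  apply Complex.ofReal_injective
  push_cast at h ⊢
  rw [← h]

/-- The cubic moment is the zeroth coefficient of a triple convolution; the triangle inequality
discards the phases. -/
theorem average_cube_le (n : ℕ) [NeZero n] (f : ZMod n → ℝ) :
    (n : ℝ)⁻¹ * ∑ x : ZMod n, f x ^ 3
      ≤ ∑ a : ZMod n, ∑ b : ZMod n, ‖cyclicCoeff n (fun x => (f x : ℂ)) a‖
        * ‖cyclicCoeff n (fun x => (f x : ℂ)) b‖
        * ‖cyclicCoeff n (fun x => (f x : ℂ)) (-(a + b))‖ := by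
  set c := cyclicCoeff n (fun x => (f x : ℂ)) with hc
  have h1 : (((n : ℝ)⁻¹ * ∑ x : ZMod n, f x ^ 3 : ℝ) : ℂ)
      = ∑ a : ZMod n, ∑ b : ZMod n, c a * c b * c (-(a + b)) := by
    have h2 : (((n : ℝ)⁻¹ * ∑ x : ZMod n, f x ^ 3 : ℝ) : ℂ)
        = cyclicCoeff n (fun x => (f x : ℂ) * ((f x : ℂ) * f x)) 0 := by
      rw [cyclicCoeff_zero]
      push_cast
      congr 1
      exact Finset.sum_congr rfl fun x _ => by ring
    rw [h2, cyclicCoeff_mul, ← Equiv.sum_comp (Equiv.neg (ZMod n))]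
    refine Finset.sum_congr rfl fun a _ => ?_
    rw [Equiv.neg_apply, cyclicCoeff_mul, Finset.mul_sum, ← Equiv.sum_comp (Equiv.refl (ZMod n))]
    refine Finset.sum_congr rfl fun b _ => ?_
    simp only [Equiv.refl_apply, sub_neg_eq_add, zero_add, ← hc]
    rw [show -(a + b) = -a - b by ring]
    ring
  calc (n : ℝ)⁻¹ * ∑ x : ZMod n, f x ^ 3
      ≤ ‖(((n : ℝ)⁻¹ * ∑ x : ZMod n, f x ^ 3 : ℝ) : ℂ)‖ := by
        rw [Complex.norm_real]; exact Real.le_norm_self _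
    _ ≤ _ := by
        rw [h1]
        refine (norm_sum_le _ _).trans (Finset.sum_le_sum fun a _ => ?_)
        refine (norm_sum_le _ _).trans (Finset.sum_le_sum fun b _ => ?_)
        rw [norm_mul, norm_mul]

/-! ### The logarithmic Sobolev inequality -/

/-- The right side is the third-order Taylor polynomial of the left at u = 1. The difference is
2u²h(u) with h(1) = 0 and h'(v) = (v - 1)³/(3v³), so h is minimal at 1. -/
theorem sq_mul_log_sq_le {u : ℝ} (hu : 0 < u) :
    u ^ 2 * Real.log (u ^ 2) ≤ 2 / 3 * u ^ 3 + u ^ 2 - 2 * u + 1 / 3 := by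
  set h : ℝ → ℝ := fun u => u / 3 + 1 / 2 - u⁻¹ + (u ^ 2)⁻¹ / 6 - Real.log u with hh
  have hd : ∀ v : ℝ, 0 < v → HasDerivAt h ((v - 1) ^ 3 / (3 * v ^ 3)) v := by
    intro v hv
    have h1 := ((((hasDerivAt_id v).div_const 3).add_const (1 / 2)).sub
      (hasDerivAt_inv hv.ne')).add (((hasDerivAt_pow 2 v).fun_inv (by positivity)).div_const 6)
    refine (h1.sub (Real.hasDerivAt_log hv.ne')).congr_deriv ?_
    field_simp
    ring
  have h0 : 0 ≤ h u := by
    have h1 : h 1 = 0 := by norm_num [hh]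
    rw [← h1]
    rcases le_total 1 u with hu1 | hu1
    · refine monotoneOn_of_deriv_nonneg (convex_Ici 1) (fun v hv => ?_) (fun v hv => ?_)
        (fun v hv => ?_) Set.self_mem_Ici hu1 hu1
      · exact (hd v (zero_lt_one.trans_le hv)).continuousAt.continuousWithinAt
      · rw [interior_Ici] at hv
        exact (hd v (zero_lt_one.trans hv)).differentiableAt.differentiableWithinAt
      · rw [interior_Ici] at hv
        have hv' : (1 : ℝ) < v := hv
        rw [(hd v (by linarith)).deriv]
        have : 0 ≤ v - 1 := by linarith
        positivity
    · refine antitoneOn_of_deriv_nonpos (convex_Ioc 0 1) (fun v hv => ?_) (fun v hv => ?_)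
        (fun v hv => ?_) ⟨hu, hu1⟩ ⟨one_pos, le_rfl⟩ hu1
      · exact (hd v hv.1).continuousAt.continuousWithinAt
      · rw [interior_Ioc] at hv
        exact (hd v hv.1).differentiableAt.differentiableWithinAt
      · rw [interior_Ioc] at hv
        rw [(hd v hv.1).deriv]
        have h2 : (v - 1) ^ 3 ≤ 0 := Odd.pow_nonpos (by decide) (by linarith [hv.2])
        have := hv.1
        exact div_nonpos_of_nonpos_of_nonneg h2 (by positivity)
  have h2 : 2 / 3 * u ^ 3 + u ^ 2 - 2 * u + 1 / 3 - u ^ 2 * Real.log (u ^ 2)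
      = 2 * u ^ 2 * h u := by
    rw [Real.log_pow, hh]
    field_simp
    push_cast
    ring
  have h3 : 0 ≤ 2 * u ^ 2 * h u := by positivity
  linarith

/-- `cubic_sum_le` for X_k = |ĝ(k)|, whose requirement X_0 = 0 is that g has mean zero. -/
theorem cubic_average_le {n m : ℕ} [NeZero n] (hm : n = 2 * m) (g : ZMod n → ℝ)
    (hg : ∑ x, g x = 0) :
    2 / 3 * ((n : ℝ)⁻¹ * ∑ x, g x ^ 3)
      ≤ 2 * ((n : ℝ)⁻¹ * ∑ x, g x * cyclicGen n g x) - 2 * ((n : ℝ)⁻¹ * ∑ x, g x ^ 2)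
        + 1 / 2 * ((n : ℝ)⁻¹ * ∑ x, g x ^ 2) ^ 2 := by
  have h0 : ‖cyclicCoeff n (fun x => (g x : ℂ)) 0‖ = 0 := by
    rw [cyclicCoeff_zero, ← Complex.ofReal_sum, hg]
    simp
  have h1 := cubic_sum_le hm (fun k => ‖cyclicCoeff n (fun x => (g x : ℂ)) k‖)
    (fun k => norm_nonneg _) (norm_cyclicCoeff_neg n g) h0
  have h2 := average_cube_le n g
  rw [average_mul_cyclicGen, average_sq]
  simp only [sub_mul, one_mul, Finset.sum_sub_distrib] at h1
  linarith

theorem cyclicGen_sub_const (n : ℕ) [NeZero n] (f : ZMod n → ℝ) (c : ℝ) :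
    ∑ x, (f x - c) * cyclicGen n (fun x => f x - c) x = ∑ x, f x * cyclicGen n f x := by
  simp only [sum_mul_cyclicGen, sub_sub_sub_cancel_right]

theorem logSobolev_normalized {n m : ℕ} [NeZero n] (hm : n = 2 * m) (f : ZMod n → ℝ)
    (hf : ∀ x, 0 < f x) (h1 : (n : ℝ)⁻¹ * ∑ x, f x ^ 2 = 1) :
    (n : ℝ)⁻¹ * ∑ x, f x ^ 2 * Real.log (f x ^ 2)
      ≤ 2 * ((n : ℝ)⁻¹ * ∑ x, f x * cyclicGen n f x) := by
  have hn : (0 : ℝ) < n := Nat.cast_pos.2 (NeZero.pos n)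
  set M := (n : ℝ)⁻¹ * ∑ x, f x with hM
  have hcard : ∑ _x : ZMod n, (1 : ℝ) = n := by simp [ZMod.card]
  have hS1 : ∑ x, f x = n * M := by rw [hM]; field_simp
  have hS2 : ∑ x, f x ^ 2 = n := by field_simp at h1; exact h1
  have hM0 : 0 ≤ M := mul_nonneg (by positivity) (Finset.sum_nonneg fun x _ => (hf x).le)
  have hg : ∑ x, (f x - M) = 0 := by
    rw [Finset.sum_sub_distrib, hS1, Finset.sum_const, Finset.card_univ, ZMod.card, nsmul_eq_mul,
      sub_self]
  have hg2 : ∑ x, (f x - M) ^ 2 = n * (1 - M ^ 2) := by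
    have : ∑ x, (f x - M) ^ 2 = ∑ x, f x ^ 2 - 2 * M * ∑ x, f x + M ^ 2 * ∑ _x : ZMod n, 1 := by
      simp only [Finset.mul_sum, ← Finset.sum_sub_distrib, ← Finset.sum_add_distrib]
      exact Finset.sum_congr rfl fun x _ => by ring
    rw [this, hS1, hS2, hcard]
    ring
  have hg3 : ∑ x, (f x - M) ^ 3 = ∑ x, f x ^ 3 - n * (3 * M - 2 * M ^ 3) := by
    have : ∑ x, (f x - M) ^ 3 = ∑ x, f x ^ 3 - 3 * M * ∑ x, f x ^ 2
        + 3 * M ^ 2 * ∑ x, f x - M ^ 3 * ∑ _x : ZMod n, 1 := by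
      simp only [Finset.mul_sum, ← Finset.sum_sub_distrib, ← Finset.sum_add_distrib]
      exact Finset.sum_congr rfl fun x _ => by ring
    rw [this, hS1, hS2, hcard]
    ring
  have hM1 : M ≤ 1 := by
    have : 0 ≤ ∑ x, (f x - M) ^ 2 := Finset.sum_nonneg fun x _ => sq_nonneg _
    rw [hg2] at this
    nlinarith [nonneg_of_mul_nonneg_right this hn]
  have hc := cubic_average_le hm (fun x => f x - M) hg
  rw [cyclicGen_sub_const] at hc
  simp only [hg2, hg3] at hc
  rw [inv_mul_cancel_left₀ hn.ne'] at hc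
  have hL : ∑ x, f x ^ 2 * Real.log (f x ^ 2)
      ≤ 2 / 3 * ∑ x, f x ^ 3 + n * (4 / 3 - 2 * M) := by
    have : 2 / 3 * ∑ x, f x ^ 3 + n * (4 / 3 - 2 * M)
        = 2 / 3 * ∑ x, f x ^ 3 + ∑ x, f x ^ 2 - 2 * ∑ x, f x + 1 / 3 * ∑ _x : ZMod n, 1 := by
      rw [hS1, hS2, hcard]; ring
    rw [this]
    simp only [Finset.mul_sum, ← Finset.sum_sub_distrib, ← Finset.sum_add_distrib]
    refine Finset.sum_le_sum fun x _ => (sq_mul_log_sq_le (hf x)).trans_eq (by ring)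
  have hL' := mul_le_mul_of_nonneg_left hL (inv_pos.2 hn).le
  have e1 : (n : ℝ)⁻¹ * (2 / 3 * ∑ x, f x ^ 3 + n * (4 / 3 - 2 * M))
      = 2 / 3 * ((n : ℝ)⁻¹ * (∑ x, f x ^ 3 - n * (3 * M - 2 * M ^ 3)))
        + (2 * M - 4 / 3 * M ^ 3) + (4 / 3 - 2 * M) := by
    field_simp
    ring
  -- With E g² = 1 - M², everything besides the energy adds up to (M - 1)³(3M + 1)/6, and 0 ≤ M ≤ 1.
  have e2 : (M - 1) ^ 3 * (3 * M + 1) ≤ 0 :=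
    mul_nonpos_of_nonpos_of_nonneg (Odd.pow_nonpos (by decide) (by linarith)) (by linarith)
  rw [e1] at hL'
  nlinarith

theorem cyclicGen_smul (n : ℕ) [NeZero n] (f : ZMod n → ℝ) (c : ℝ) (x : ZMod n) :
    cyclicGen n (fun x => c * f x) x = c * cyclicGen n f x := by
  simp only [cyclicGen, Finset.mul_sum]
  exact Finset.sum_congr rfl fun y _ => by ring

/-- The logarithmic Sobolev inequality on the cyclic groups of even order. -/
theorem logSobolev {n m : ℕ} [NeZero n] (hm : n = 2 * m) (f : ZMod n → ℝ) (hf : ∀ x, 0 < f x) :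
    (n : ℝ)⁻¹ * ∑ x, f x ^ 2 * Real.log (f x ^ 2)
        - ((n : ℝ)⁻¹ * ∑ x, f x ^ 2) * Real.log ((n : ℝ)⁻¹ * ∑ x, f x ^ 2)
      ≤ 2 * ((n : ℝ)⁻¹ * ∑ x, f x * cyclicGen n f x) := by
  have hn : (0 : ℝ) < n := Nat.cast_pos.2 (NeZero.pos n)
  set A := (n : ℝ)⁻¹ * ∑ x, f x ^ 2 with hA
  have hA0 : 0 < A := mul_pos (by positivity)
    (Finset.sum_pos (fun x _ => pow_pos (hf x) 2) Finset.univ_nonempty)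
  set s := (Real.sqrt A)⁻¹ with hs
  have hs0 : 0 < s := inv_pos.2 (Real.sqrt_pos.2 hA0)
  have hs2 : s ^ 2 = A⁻¹ := by rw [hs, inv_pow, Real.sq_sqrt hA0.le]
  have h := logSobolev_normalized hm (fun x => s * f x) (fun x => mul_pos hs0 (hf x)) (by
    simp only [mul_pow, ← Finset.mul_sum]
    rw [mul_left_comm, ← hA, hs2, inv_mul_cancel₀ hA0.ne'])
  have e1 : ∑ x, (s * f x) ^ 2 * Real.log ((s * f x) ^ 2)
      = A⁻¹ * (∑ x, f x ^ 2 * Real.log (f x ^ 2) - Real.log A * ∑ x, f x ^ 2) := by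
    rw [Finset.mul_sum, ← Finset.sum_sub_distrib, Finset.mul_sum]
    refine Finset.sum_congr rfl fun x _ => ?_
    rw [mul_pow, hs2, Real.log_mul (by positivity) (pow_pos (hf x) 2).ne', Real.log_inv]
    ring
  have e2 : ∑ x, s * f x * cyclicGen n (fun x => s * f x) x
      = A⁻¹ * ∑ x, f x * cyclicGen n f x := by
    rw [Finset.mul_sum]
    refine Finset.sum_congr rfl fun x _ => ?_
    rw [cyclicGen_smul, ← hs2]
    ring
  rw [e1, e2] at h
  have h' := mul_le_mul_of_nonneg_left h hA0.le
  have e3 : A * ((n : ℝ)⁻¹ * (A⁻¹ * (∑ x, f x ^ 2 * Real.log (f x ^ 2)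
      - Real.log A * ∑ x, f x ^ 2)))
      = (n : ℝ)⁻¹ * ∑ x, f x ^ 2 * Real.log (f x ^ 2) - A * Real.log A := by
    have hS : ∑ x, f x ^ 2 = n * A := by rw [hA]; field_simp
    rw [hS]
    field_simp
  have e4 : A * (2 * ((n : ℝ)⁻¹ * (A⁻¹ * ∑ x, f x * cyclicGen n f x)))
      = 2 * ((n : ℝ)⁻¹ * ∑ x, f x * cyclicGen n f x) := by
    field_simp
  rwa [e3, e4] at h'

/-! ### The Stroock–Varopoulos inequality -/

theorem sinh_mul_le {c x : ℝ} (hc0 : 0 ≤ c) (hc1 : c ≤ 1) (hx : 0 ≤ x) :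
    Real.sinh (c * x) ≤ c * Real.sinh x := by
  have hd : ∀ y : ℝ, HasDerivAt (fun y => c * Real.sinh y - Real.sinh (c * y))
      (c * Real.cosh y - Real.cosh (c * y) * (c * 1)) y := fun y =>
    ((Real.hasDerivAt_sinh y).const_mul c).sub (((hasDerivAt_id y).const_mul c).sinh)
  have h := monotoneOn_of_deriv_nonneg (convex_Ici (0 : ℝ))
    (fun y _ => (hd y).continuousAt.continuousWithinAt)
    (fun y _ => (hd y).differentiableAt.differentiableWithinAt) (fun y hy => by
      rw [interior_Ici] at hy
      have hy' : (0 : ℝ) < y := hy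
      rw [(hd y).deriv]
      have : Real.cosh (c * y) ≤ Real.cosh y := by
        rw [Real.cosh_le_cosh, abs_of_nonneg (by positivity), abs_of_pos hy']
        nlinarith
      nlinarith) Set.self_mem_Ici hx hx
  simp at h
  linarith

theorem sinh_mul_sq_le {c : ℝ} (hc : |c| ≤ 1) (x : ℝ) :
    Real.sinh (c * x) ^ 2 ≤ c ^ 2 * Real.sinh x ^ 2 := by
  have h := sinh_mul_le (abs_nonneg c) hc (abs_nonneg x)
  have h0 : 0 ≤ Real.sinh (|c| * |x|) := Real.sinh_nonneg_iff.2 (by positivity)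
  have h1 := pow_le_pow_left₀ h0 h 2
  rwa [← abs_mul, ← Real.abs_sinh, ← Real.abs_sinh, mul_pow, sq_abs, sq_abs, sq_abs] at h1

/-- The pointwise Stroock–Varopoulos inequality. -/
theorem stroock_varopoulos {a b q : ℝ} (ha : 0 < a) (hb : 0 < b) (hq : 1 < q) :
    4 * (q - 1) / q ^ 2 * (a ^ (q / 2) - b ^ (q / 2)) ^ 2
      ≤ (a ^ (q - 1) - b ^ (q - 1)) * (a - b) := by
  obtain ⟨A, rfl⟩ : ∃ A, a = Real.exp A := ⟨_, (Real.exp_log ha).symm⟩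
  obtain ⟨B, rfl⟩ : ∃ B, b = Real.exp B := ⟨_, (Real.exp_log hb).symm⟩
  have hdiff : ∀ r : ℝ, Real.exp A ^ r - Real.exp B ^ r
      = Real.exp (r * ((A + B) / 2)) * (2 * Real.sinh (r * ((A - B) / 2))) := by
    intro r
    rw [← Real.exp_mul, ← Real.exp_mul, Real.sinh_eq]
    rw [show A * r = r * ((A + B) / 2) + r * ((A - B) / 2) by ring,
      show B * r = r * ((A + B) / 2) + -(r * ((A - B) / 2)) by ring, Real.exp_add, Real.exp_add]
    ring
  have h1 := hdiff 1
  rw [Real.rpow_one, Real.rpow_one] at h1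
  rw [h1, hdiff, hdiff]
  set y := (A - B) / 2
  set w := (A + B) / 2
  have hq0 : 0 < q := by linarith
  -- The ratio c = (q - 2)/q is chosen so that q/2 · (1 ± c) are q - 1 and 1, and 1 - c² = 4(q -
  -- 1)/q². The identity sinh(s + r) sinh(s - r) = sinh² s - sinh² r then reduces the claim to
  -- sinh²(cs) ≤ c² sinh² s.
  have key := sinh_mul_sq_le (c := (q - 2) / q) (by
    rw [abs_div, abs_of_pos hq0, div_le_one hq0, abs_le]
    constructor <;> linarith) (q / 2 * y)
  have hid : Real.sinh ((q - 1) * y) * Real.sinh (1 * y)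
      = Real.sinh (q / 2 * y) ^ 2 - Real.sinh ((q - 2) / q * (q / 2 * y)) ^ 2 := by
    rw [show (q - 1) * y = q / 2 * y + (q - 2) / q * (q / 2 * y) by field_simp; ring,
      show 1 * y = q / 2 * y - (q - 2) / q * (q / 2 * y) by field_simp; ring,
      Real.sinh_add, Real.sinh_sub]
    have c1 := Real.cosh_sq (q / 2 * y)
    have c2 := Real.cosh_sq ((q - 2) / q * (q / 2 * y))
    linear_combination (-Real.sinh ((q - 2) / q * (q / 2 * y)) ^ 2) * c1
      + (Real.sinh (q / 2 * y) ^ 2) * c2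
  have hexp : Real.exp ((q - 1) * w) * Real.exp (1 * w) = Real.exp (q / 2 * w) ^ 2 := by
    rw [← Real.exp_add, sq, ← Real.exp_add]
    ring_nf
  have hc : 4 * (q - 1) / q ^ 2 = 1 - ((q - 2) / q) ^ 2 := by field_simp; ring
  calc 4 * (q - 1) / q ^ 2 * (Real.exp (q / 2 * w) * (2 * Real.sinh (q / 2 * y))) ^ 2
      = 4 * Real.exp (q / 2 * w) ^ 2 *
        (Real.sinh (q / 2 * y) ^ 2 - ((q - 2) / q) ^ 2 * Real.sinh (q / 2 * y) ^ 2) := by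
        rw [hc]; ring
    _ ≤ 4 * Real.exp (q / 2 * w) ^ 2 *
        (Real.sinh ((q - 1) * y) * Real.sinh (1 * y)) := by
        rw [hid]; gcongr
    _ = _ := by rw [← hexp]; ring

/-- The pointwise inequality summed against the off-diagonal weights of the Dirichlet form, which
are nonnegative. -/
theorem dirichlet_rpow_le {n m : ℕ} [NeZero n] (hm : n = 2 * m) (u : ZMod n → ℝ)
    (hu : ∀ x, 0 < u x) {q : ℝ} (hq : 1 < q) :
    4 * (q - 1) * ∑ x, u x ^ (q / 2) * cyclicGen n (fun x => u x ^ (q / 2)) x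
      ≤ q ^ 2 * ∑ x, u x ^ (q - 1) * cyclicGen n u x := by
  have hq2 : 0 < q ^ 2 := by positivity
  have h : 4 * (q - 1) / q ^ 2 * ∑ x, u x ^ (q / 2) * cyclicGen n (fun x => u x ^ (q / 2)) x
      ≤ ∑ x, u x ^ (q - 1) * cyclicGen n u x := by
    rw [sum_mul_cyclicGen, sum_mul_cyclicGen n (fun x => u x ^ (q - 1)), mul_left_comm]
    refine mul_le_mul_of_nonneg_left ?_ (by norm_num)
    simp only [Finset.mul_sum]
    refine Finset.sum_le_sum fun x _ => Finset.sum_le_sum fun y _ => ?_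
    by_cases hxy : x = y
    · simp [hxy]
    · rw [mul_left_comm, ← sq]
      exact mul_le_mul_of_nonneg_left (stroock_varopoulos (hu x) (hu y) hq)
        (neg_nonneg.2 (multiplierKernel_wordLength_nonpos hm (sub_ne_zero.2 hxy)))
  rw [div_mul_eq_mul_div, div_le_iff₀ hq2] at h
  linarith

/-! ### The semigroup on positive functions and monotonicity of the norm -/

/-- The Poisson-like semigroup, acting on real functions. -/
def realSemigroup (n : ℕ) [NeZero n] (t : ℝ) (f : ZMod n → ℝ) (x : ZMod n) : ℝ :=
  ∑ y : ZMod n, multiplierKernel n (fun k => Real.exp (-t * wordLength n k)) (x - y) * f y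

theorem ofReal_realSemigroup (n : ℕ) [NeZero n] (t : ℝ) (f : ZMod n → ℝ) (x : ZMod n) :
    (realSemigroup n t f x : ℂ) = ∑ k : ZMod n, (Real.exp (-t * wordLength n k) : ℂ) *
      cyclicCoeff n (fun x => (f x : ℂ)) k * stdAddChar (k * x) := by
  rw [← poissonSemigroup_apply, poissonSemigroup_eq_convolution, realSemigroup]
  push_cast
  rfl

theorem realSemigroup_zero (n : ℕ) [NeZero n] (f : ZMod n → ℝ) : realSemigroup n 0 f = f := by
  funext x
  apply Complex.ofReal_injective
  rw [ofReal_realSemigroup]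
  simp [sum_cyclicCoeff_mul]

/-- The kernel is nonnegative of total mass 1, hence some entry is positive. Strict positivity is
needed to differentiate real powers and logarithms along the flow. -/
theorem realSemigroup_pos {n m : ℕ} [NeZero n] (hm : n = 2 * m) {t : ℝ} (ht : 0 ≤ t)
    (f : ZMod n → ℝ) (hf : ∀ x, 0 < f x) (x : ZMod n) : 0 < realSemigroup n t f x := by
  have h0 : ∑ y : ZMod n,
      multiplierKernel n (fun k => Real.exp (-t * wordLength n k)) (x - y) = 1 := by
    refine (Equiv.sum_comp (Equiv.subLeft x)
      (multiplierKernel n fun k => Real.exp (-t * wordLength n k))).trans ?_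
    rw [sum_multiplierKernel, wordLength_zero]
    simp
  have hnn := fun y => multiplierKernel_exp_nonneg hm ht (x - y)
  obtain ⟨y, -, hy⟩ := Finset.exists_ne_zero_of_sum_ne_zero (by rw [h0]; exact one_ne_zero)
  exact Finset.sum_pos' (fun y _ => mul_nonneg (hnn y) (hf y).le)
    ⟨y, Finset.mem_univ _, mul_pos (lt_of_le_of_ne (hnn y) (Ne.symm hy)) (hf y)⟩

theorem hasDerivAt_realSemigroup (n : ℕ) [NeZero n] (t : ℝ) (f : ZMod n → ℝ) (x : ZMod n) :
    HasDerivAt (fun t => realSemigroup n t f x) (-cyclicGen n (realSemigroup n t f) x) t := by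
  set c := fun k => (cyclicCoeff n (fun x => (f x : ℂ)) k * stdAddChar (k * x) : ℂ).re with hc
  have h1 : ∀ t, realSemigroup n t f x = ∑ k, Real.exp (-t * wordLength n k) * c k := by
    intro t
    rw [← Complex.ofReal_re (realSemigroup n t f x), ofReal_realSemigroup, Complex.re_sum]
    refine Finset.sum_congr rfl fun k _ => ?_
    rw [mul_assoc, Complex.re_ofReal_mul]
  have h2 : cyclicGen n (realSemigroup n t f) x
      = ∑ k, wordLength n k * (Real.exp (-t * wordLength n k) * c k) := by
    rw [← Complex.ofReal_re (cyclicGen n (realSemigroup n t f) x), ofReal_cyclicGen,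
      Complex.re_sum]
    refine Finset.sum_congr rfl fun k _ => ?_
    simp only [ofReal_realSemigroup, cyclicCoeff_sum]
    rw [mul_assoc, mul_assoc, ← Complex.ofReal_natCast, Complex.re_ofReal_mul,
      Complex.re_ofReal_mul]
  simp only [h1]
  rw [h2, ← Finset.sum_neg_distrib]
  refine HasDerivAt.fun_sum fun k _ => ?_
  have h3 : HasDerivAt (fun t : ℝ => -t * (wordLength n k : ℝ)) (-1 * (wordLength n k : ℝ)) t :=
    (hasDerivAt_id t).neg.mul_const _
  exact (h3.exp.mul_const (c k)).congr_deriv (by ring)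

/-- Hypercontractivity on positive functions along the optimal exponent curve. -/
theorem realSemigroup_hypercontractive {n m : ℕ} [NeZero n] (hm : n = 2 * m) {p t : ℝ}
    (hp : 1 < p) (ht : 0 ≤ t) (f : ZMod n → ℝ) (hf : ∀ x, 0 < f x) :
    ((n : ℝ)⁻¹ * ∑ x, realSemigroup n t f x ^ (1 + (p - 1) * Real.exp (2 * t)))
        ^ (1 / (1 + (p - 1) * Real.exp (2 * t)))
      ≤ ((n : ℝ)⁻¹ * ∑ x, f x ^ p) ^ (1 / p) := by
  have hn : (0 : ℝ) < n := Nat.cast_pos.2 (NeZero.pos n)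
  set q : ℝ → ℝ := fun t => 1 + (p - 1) * Real.exp (2 * t) with hq
  set N : ℝ → ℝ := fun t => (n : ℝ)⁻¹ * ∑ x, realSemigroup n t f x ^ q t with hN
  have hq1 : ∀ t, 1 < q t := fun t => by
    have := mul_pos (sub_pos.2 hp) (Real.exp_pos (2 * t))
    simp only [hq]; linarith
  -- The exponent solves q' = 2(q - 1), q(0) = p, which makes the entropy and energy terms balance
  -- exactly.
  have hqd : ∀ t, HasDerivAt q (2 * (q t - 1)) t := by
    intro t
    have h := ((((hasDerivAt_id t).const_mul 2).exp).const_mul (p - 1)).const_add 1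
    refine h.congr_deriv ?_
    simp only [hq, id]; ring
  have hpos : ∀ t, 0 ≤ t → ∀ x, 0 < realSemigroup n t f x :=
    fun t ht x => realSemigroup_pos hm ht f hf x
  have hNpos : ∀ t, 0 ≤ t → 0 < N t := fun t ht => mul_pos (by positivity)
    (Finset.sum_pos (fun x _ => Real.rpow_pos_of_pos (hpos t ht x) _) Finset.univ_nonempty)
  have hNd : ∀ t, 0 ≤ t → HasDerivAt N ((n : ℝ)⁻¹ * ∑ x,
      (-cyclicGen n (realSemigroup n t f) x * q t * realSemigroup n t f x ^ (q t - 1)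
        + 2 * (q t - 1) * realSemigroup n t f x ^ q t * Real.log (realSemigroup n t f x))) t :=
    fun t ht => (HasDerivAt.fun_sum fun x _ =>
      (hasDerivAt_realSemigroup n t f x).rpow (hqd t) (hpos t ht x)).const_mul _
  have hFd := fun t ht => ((hNd t ht).log (hNpos t ht).ne').div (hqd t) (by
    linarith [hq1 t] : q t ≠ 0)
  have hanti : AntitoneOn (fun t => Real.log (N t) / q t) (Set.Ici 0) := by
    refine antitoneOn_of_deriv_nonpos (convex_Ici 0)
      (fun t ht => (hFd t ht).continuousAt.continuousWithinAt)
      (fun t ht => ?_) (fun t ht => ?_)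
    · rw [interior_Ici] at ht
      exact (hFd t (le_of_lt ht)).differentiableAt.differentiableWithinAt
    · rw [interior_Ici] at ht
      have ht : 0 ≤ t := le_of_lt ht
      refine (hFd t ht).deriv.trans_le ?_
      refine div_nonpos_of_nonpos_of_nonneg ?_ (sq_nonneg _)
      set u := realSemigroup n t f with hu
      have hup : ∀ x, 0 < u x := hpos t ht
      have hls := logSobolev hm (fun x => u x ^ (q t / 2))
        (fun x => Real.rpow_pos_of_pos (hup x) _)
      have hsv := dirichlet_rpow_le hm u hup (hq1 t)
      have e : ∀ x, (u x ^ (q t / 2)) ^ 2 = u x ^ q t := by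
        intro x
        rw [← Real.rpow_natCast, ← Real.rpow_mul (hup x).le]
        congr 1
        push_cast
        ring
      simp only [e, Real.log_rpow (hup _)] at hls
      have eN : (n : ℝ)⁻¹ * ∑ x, u x ^ q t = N t := rfl
      rw [eN] at hls
      have e2 : ∑ x, (-cyclicGen n u x * q t * u x ^ (q t - 1)
          + 2 * (q t - 1) * u x ^ q t * Real.log (u x))
          = 2 * (q t - 1) * ∑ x, u x ^ q t * Real.log (u x)
            - q t * ∑ x, u x ^ (q t - 1) * cyclicGen n u x := by
        rw [Finset.mul_sum, Finset.mul_sum, ← Finset.sum_sub_distrib]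
        exact Finset.sum_congr rfl fun x _ => by ring
      have e3 : ∑ x, u x ^ q t * (q t * Real.log (u x))
          = q t * ∑ x, u x ^ q t * Real.log (u x) := by
        rw [Finset.mul_sum]
        exact Finset.sum_congr rfl fun x _ => by ring
      rw [e3] at hls
      rw [e2]
      have hN0 := hNpos t ht
      have hq1' := hq1 t
      set E := ∑ x, u x ^ q t * Real.log (u x)
      set D := ∑ x, u x ^ (q t - 1) * cyclicGen n u x
      set V := ∑ x, u x ^ (q t / 2) * cyclicGen n (fun x => u x ^ (q t / 2)) x
      -- This is N'q ≤ q'N log N: the logarithmic Sobolev inequality for u^{q/2}, times 2(q - 1),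
      -- with its energy bounded by Stroock–Varopoulos.
      have h1 : (n : ℝ)⁻¹ * (2 * (q t - 1) * E - q t * D) * q t
          ≤ 2 * (q t - 1) * (N t * Real.log (N t)) := by
        have h2 := mul_le_mul_of_nonneg_left hls (by linarith : 0 ≤ 2 * (q t - 1))
        have h3 := mul_le_mul_of_nonneg_left hsv (inv_pos.2 hn).le
        nlinarith
      rw [sub_nonpos, div_mul_eq_mul_div, div_le_iff₀ hN0]
      linarith
  have h := hanti Set.self_mem_Ici (Set.mem_Ici.2 ht) ht
  have hq0 : q 0 = p := by simp [hq]
  have hN0 : N 0 = (n : ℝ)⁻¹ * ∑ x, f x ^ p := by simp only [hN, hq0, realSemigroup_zero]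
  change N t ^ (1 / q t) ≤ _
  rw [← hN0, ← hq0, Real.rpow_def_of_pos (hNpos t ht), Real.rpow_def_of_pos (hNpos 0 le_rfl),
    Real.exp_le_exp, mul_one_div, mul_one_div]
  exact h

/-! ### Sufficiency for complex functions -/

theorem cyclicLpNorm_mono {n : ℕ} [NeZero n] {q r : ℝ} (hq : 0 < q) (hqr : q ≤ r)
    (f : ZMod n → ℂ) : cyclicLpNorm n q f ≤ cyclicLpNorm n r f := by
  have hn : (n : ℝ) ≠ 0 := Nat.cast_ne_zero.mpr (NeZero.ne n)
  have hr : 0 < r := hq.trans_le hqr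
  rw [cyclicLpNorm_eq n q hq, cyclicLpNorm_eq n r hr]
  have h := Real.rpow_arith_mean_le_arith_mean_rpow Finset.univ (fun _ : ZMod n => (n : ℝ)⁻¹)
    (fun x => ‖f x‖ ^ q) (fun _ _ => by positivity) (by simp [ZMod.card, hn])
    (fun x _ => by positivity) ((one_le_div hq).2 hqr)
  simp only [← Real.rpow_mul (norm_nonneg _), mul_div_cancel₀ _ hq.ne', ← Finset.mul_sum] at h
  have hS : 0 ≤ (n : ℝ)⁻¹ * ∑ x, ‖f x‖ ^ q :=
    mul_nonneg (by positivity) (Finset.sum_nonneg fun x _ => by positivity)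
  have h2 := Real.rpow_le_rpow (by positivity) h (by positivity : 0 ≤ 1 / r)
  rw [← Real.rpow_mul hS] at h2
  rwa [show r / q * (1 / r) = 1 / q by field_simp] at h2

/-- Positivity of the kernel reduces complex f to |f|; the shift ε makes the comparison function
strictly positive and is later sent to 0. -/
theorem norm_poissonSemigroup_le {n m : ℕ} [NeZero n] (hm : n = 2 * m) {t : ℝ} (ht : 0 ≤ t)
    (f : ZMod n → ℂ) {ε : ℝ} (hε : 0 ≤ ε) (x : ZMod n) :
    ‖poissonSemigroup n t f x‖ ≤ realSemigroup n t (fun x => ‖f x‖ + ε) x := by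
  rw [poissonSemigroup_eq_convolution, realSemigroup]
  refine (norm_sum_le _ _).trans (Finset.sum_le_sum fun y _ => ?_)
  have := multiplierKernel_exp_nonneg hm ht (x - y)
  rw [norm_mul, Complex.norm_real, Real.norm_of_nonneg this]
  exact mul_le_mul_of_nonneg_left (by linarith) this

/-- Optimal hypercontractivity of the Poisson-like semigroup on cyclic groups of even order. -/
theorem poissonSemigroup_hypercontractive {n m : ℕ} [NeZero n] (hm : n = 2 * m) {p q t : ℝ}
    (hp : 1 < p) (hpq : p ≤ q) (ht : 0 ≤ t)
    (h : 1 / 2 * Real.log ((q - 1) / (p - 1)) ≤ t) (f : ZMod n → ℂ) :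
    cyclicLpNorm n q (poissonSemigroup n t f) ≤ cyclicLpNorm n p f := by
  have hp1 : 0 < p - 1 := by linarith
  have hq1 : 0 < q - 1 := by linarith
  -- The exponent reached at time t is r ≥ q, and norms for a probability measure increase with the
  -- exponent.
  set r := 1 + (p - 1) * Real.exp (2 * t) with hr
  have hqr : q ≤ r := by
    have h1 : (q - 1) / (p - 1) ≤ Real.exp (2 * t) := by
      rw [← Real.log_le_iff_le_exp (by positivity)]
      linarith
    rw [div_le_iff₀ hp1] at h1
    linarith
  refine (cyclicLpNorm_mono (by linarith) hqr _).trans ?_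
  have key : ∀ ε : ℝ, 0 < ε → cyclicLpNorm n r (poissonSemigroup n t f)
      ≤ ((n : ℝ)⁻¹ * ∑ x, (‖f x‖ + ε) ^ p) ^ (1 / p) := by
    intro ε hε
    refine le_trans ?_ (realSemigroup_hypercontractive hm hp ht (fun x => ‖f x‖ + ε)
      fun x => by positivity)
    rw [cyclicLpNorm_eq n r (by linarith)]
    have hr0 : 0 < r := by linarith
    refine Real.rpow_le_rpow (mul_nonneg (by positivity)
      (Finset.sum_nonneg fun x _ => by positivity)) ?_ (by positivity)
    refine mul_le_mul_of_nonneg_left (Finset.sum_le_sum fun x _ => ?_) (by positivity)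
    exact Real.rpow_le_rpow (norm_nonneg _) (norm_poissonSemigroup_le hm ht f hε.le x) hr0.le
  have hcont : Filter.Tendsto (fun ε : ℝ => ((n : ℝ)⁻¹ * ∑ x, (‖f x‖ + ε) ^ p) ^ (1 / p))
      (nhdsWithin 0 (Set.Ioi 0)) (nhds (cyclicLpNorm n p f)) := by
    have hc : Continuous fun ε : ℝ => ((n : ℝ)⁻¹ * ∑ x, (‖f x‖ + ε) ^ p) ^ (1 / p) := by
      refine Continuous.rpow_const (continuous_const.mul (continuous_finsetSum _ fun x _ =>
        (continuous_const.add continuous_id).rpow_const fun _ => .inr (by linarith)))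
        fun _ => .inr (by positivity)
    have := hc.tendsto 0
    simp only [add_zero] at this
    rw [← cyclicLpNorm_eq n p (by linarith)] at this
    exact this.mono_left nhdsWithin_le_nhds
  exact ge_of_tendsto hcont (Filter.eventually_of_mem self_mem_nhdsWithin fun ε hε => key ε hε)

/-! ### Necessity by perturbing constants -/

theorem tendsto_rpow_second_order (p c : ℝ) :
    Filter.Tendsto (fun x : ℝ => ((1 + c * x) ^ p - 1 - p * c * x) / x ^ 2)
      (nhdsWithin 0 (Set.Ioi 0)) (nhds (p * (p - 1) / 2 * c ^ 2)) := by
  have hlin : ∀ x : ℝ, HasDerivAt (fun x : ℝ => 1 + c * x) c x := fun x =>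
    (((hasDerivAt_id x).const_mul c).const_add 1).congr_deriv (by ring)
  have hne : ∀ᶠ x : ℝ in nhdsWithin 0 (Set.Ioi 0), 1 + c * x ≠ 0 := by
    have hc : ContinuousAt (fun x : ℝ => 1 + c * x) 0 := (hlin 0).continuousAt
    exact nhdsWithin_le_nhds (hc.eventually_ne (by simp))
  have hf : ∀ (x : ℝ), 1 + c * x ≠ 0 → HasDerivAt
      (fun x : ℝ => (1 + c * x) ^ p - 1 - p * c * x) (c * p * (1 + c * x) ^ (p - 1) - p * c) x :=
    fun x hx => ((((hlin x).rpow_const (.inl hx)).sub_const 1).sub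
      ((hasDerivAt_id x).const_mul (p * c))).congr_deriv (by ring)
  refine HasDerivAt.lhopital_zero_nhdsGT
    (f' := fun x : ℝ => c * p * (1 + c * x) ^ (p - 1) - p * c) (g' := fun x : ℝ => 2 * x)
    (hne.mono hf)
    (Filter.Eventually.of_forall fun x => (hasDerivAt_pow 2 x).congr_deriv (by norm_num))
    (Filter.eventually_of_mem self_mem_nhdsWithin fun x hx =>
      mul_ne_zero two_ne_zero (ne_of_gt hx)) ?_ ?_ ?_
  · have := (hf 0 (by simp)).continuousAt.tendsto
    simp only [mul_zero, add_zero, Real.one_rpow, sub_self] at this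
    exact this.mono_left nhdsWithin_le_nhds
  · have : Filter.Tendsto (fun x : ℝ => x ^ 2) (nhds 0) (nhds (0 ^ 2)) :=
      (continuous_pow 2).tendsto 0
    rw [zero_pow two_ne_zero] at this
    exact this.mono_left nhdsWithin_le_nhds
  -- After one use of l'Hôpital's rule, the remaining quotient is the slope at 0 of (1 + cx)^{p-1},
  -- times cp/2.
  · have h := (((hlin 0).rpow_const (p := p - 1) (.inl (by simp))).const_mul (c * p / 2))
    have h2 := h.tendsto_slope.mono_left
      (nhdsWithin_mono 0 fun x (hx : x ∈ Set.Ioi (0 : ℝ)) => ne_of_gt hx)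
    have h3 : c * p / 2 * (c * (p - 1) * (1 + c * 0) ^ (p - 1 - 1))
        = p * (p - 1) / 2 * c ^ 2 := by
      simp only [mul_zero, add_zero, Real.one_rpow]; ring
    rw [h3] at h2
    refine h2.congr' (Filter.eventually_of_mem self_mem_nhdsWithin fun x hx => ?_)
    have hx0 : x ≠ 0 := ne_of_gt hx
    rw [slope_def_field]
    simp only [mul_zero, add_zero, Real.one_rpow, sub_zero]
    field_simp

/-- Second order expansion of the `L_p` norm of `1 + c ε g` when `g` has mean zero, in the
variable `h = ε ^ 2`. -/
theorem hasDerivWithinAt_norm_perturbation (n : ℕ) [NeZero n] (g : ZMod n → ℝ)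
    (hg : ∑ x, g x = 0) {p : ℝ} (hp : 0 < p) (c : ℝ) :
    HasDerivWithinAt
      (fun h : ℝ => ((n : ℝ)⁻¹ * ∑ x, (1 + c * g x * √h) ^ p) ^ (1 / p))
      ((p - 1) / 2 * c ^ 2 * ((n : ℝ)⁻¹ * ∑ x, g x ^ 2)) (Set.Ioi 0) 0 := by
  have hn : (n : ℝ) ≠ 0 := Nat.cast_ne_zero.mpr (NeZero.ne n)
  have hsqrt : Filter.Tendsto Real.sqrt (nhdsWithin 0 (Set.Ioi 0)) (nhdsWithin 0 (Set.Ioi 0)) := by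
    refine tendsto_nhdsWithin_iff.2 ⟨?_, Filter.eventually_of_mem self_mem_nhdsWithin
      fun x hx => Real.sqrt_pos.2 hx⟩
    have := Real.continuous_sqrt.tendsto 0
    rw [Real.sqrt_zero] at this
    exact this.mono_left nhdsWithin_le_nhds
  -- The term linear in √h need not be differentiable at 0, so it is subtracted pointwise; its sum
  -- vanishes since g has mean zero.
  have h1 : ∀ x, HasDerivWithinAt
      (fun h : ℝ => (1 + c * g x * √h) ^ p - 1 - p * (c * g x) * √h)
      (p * (p - 1) / 2 * (c * g x) ^ 2) (Set.Ioi 0) 0 := by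
    intro x
    rw [hasDerivWithinAt_iff_tendsto_slope' (by simp)]
    refine ((tendsto_rpow_second_order p (c * g x)).comp hsqrt).congr'
      (Filter.eventually_of_mem self_mem_nhdsWithin fun h hh => ?_)
    rw [slope_def_field]
    simp [Real.sq_sqrt (le_of_lt hh)]
  have h2 := ((HasDerivWithinAt.fun_sum (u := Finset.univ) fun x _ => h1 x).const_mul
    ((n : ℝ)⁻¹)).const_add 1
  have e : ∀ h : ℝ, 1 + (n : ℝ)⁻¹ * ∑ x, ((1 + c * g x * √h) ^ p - 1 - p * (c * g x) * √h)
      = (n : ℝ)⁻¹ * ∑ x, (1 + c * g x * √h) ^ p := by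
    intro h
    have e1 : ∑ x, p * (c * g x) * √h = 0 := by
      have : ∑ x, p * (c * g x) * √h = p * c * √h * ∑ x, g x := by
        rw [Finset.mul_sum]
        exact Finset.sum_congr rfl fun x _ => by ring
      rw [this, hg, mul_zero]
    rw [Finset.sum_sub_distrib, Finset.sum_sub_distrib, e1, Finset.sum_const, Finset.card_univ,
      ZMod.card, nsmul_eq_mul, sub_zero, mul_one, mul_sub, inv_mul_cancel₀ hn,
      add_sub_cancel]
  simp only [e] at h2
  have hval : (n : ℝ)⁻¹ * ∑ x : ZMod n, (1 + c * g x * √0) ^ p = 1 := by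
    simp [ZMod.card, hn]
  refine (h2.rpow_const (p := 1 / p) (.inl (by rw [hval]; exact one_ne_zero))).congr_deriv ?_
  rw [hval, Real.one_rpow]
  simp only [mul_pow, ← mul_assoc, ← Finset.mul_sum]
  field_simp

theorem poissonSemigroup_char (n : ℕ) [NeZero n] (t : ℝ) (j : ZMod n) :
    poissonSemigroup n t (fun x => stdAddChar (j * x))
      = fun x => (Real.exp (-t * wordLength n j) : ℂ) * stdAddChar (j * x) := by
  have h := poissonSemigroup_sum n t (Pi.single j 1)
  simpa [cyclicChar_eq_stdAddChar, Pi.single_apply] using h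

theorem poissonSemigroup_perturbation (n : ℕ) [NeZero n] (hn : 2 ≤ n) (t ε : ℝ) :
    poissonSemigroup n t (fun x => ((1 + ε * (stdAddChar x : ℂ).re : ℝ) : ℂ))
      = fun x => ((1 + Real.exp (-t) * ε * (stdAddChar x : ℂ).re : ℝ) : ℂ) := by
  have : Fact (1 < n) := ⟨hn⟩
  have h1 : wordLength n 1 = 1 := by
    rw [wordLength, ZMod.val_one]; omega
  have hre : ∀ x : ZMod n, (((stdAddChar x : ℂ).re : ℝ) : ℂ)
      = (1 / 2) * (stdAddChar (1 * x) + stdAddChar (-1 * x)) := by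
    intro x
    rw [one_mul, neg_one_mul, AddChar.map_neg_eq_conj, Complex.add_conj]
    push_cast
    ring
  have hf : (fun x : ZMod n => ((1 + ε * (stdAddChar x : ℂ).re : ℝ) : ℂ))
      = (fun x => stdAddChar (0 * x)) + (ε / 2 : ℂ) • (fun x => stdAddChar (1 * x))
        + (ε / 2 : ℂ) • (fun x => stdAddChar (-1 * x)) := by
    funext x
    push_cast
    rw [hre]
    simp only [Pi.add_apply, Pi.smul_apply, smul_eq_mul, zero_mul, AddChar.map_zero_eq_one]
    ring
  rw [hf, map_add, map_add, _root_.map_smul, _root_.map_smul, poissonSemigroup_char, poissonSemigroup_char,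
    poissonSemigroup_char, wordLength_neg, h1, wordLength_zero]
  funext x
  rw [Complex.ofReal_add, Complex.ofReal_mul, hre]
  simp only [Pi.add_apply, Pi.smul_apply, smul_eq_mul, zero_mul, AddChar.map_zero_eq_one,
    Nat.cast_zero, mul_zero, Real.exp_zero, Nat.cast_one, mul_one]
  push_cast
  ring

/-- Testing on perturbations of constants shows that the time `½ log ((q - 1) / (p - 1))` is
necessary for hypercontractivity. -/
theorem le_of_poissonSemigroup_hypercontractive (n : ℕ) [NeZero n] (hn : 2 ≤ n) {p q t : ℝ}
    (hp : 1 < p) (hq : 1 < q)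
    (h : ∀ f : ZMod n → ℂ, cyclicLpNorm n q (poissonSemigroup n t f) ≤ cyclicLpNorm n p f) :
    1 / 2 * Real.log ((q - 1) / (p - 1)) ≤ t := by
  have hn0 : (0 : ℝ) < n := Nat.cast_pos.2 (NeZero.pos n)
  have : Fact (1 < n) := ⟨hn⟩
  set g : ZMod n → ℝ := fun x => (stdAddChar x : ℂ).re with hg
  have hg0 : ∑ x, g x = 0 := by
    have h1 := sum_stdAddChar_mul n 1
    simp only [one_mul, one_ne_zero, if_false] at h1
    rw [hg, ← Complex.re_sum, h1, Complex.zero_re]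
  have hg1 : ∀ x, |g x| ≤ 1 := fun x =>
    (Complex.abs_re_le_norm _).trans (by rw [AddChar.norm_apply])
  set G := (n : ℝ)⁻¹ * ∑ x, g x ^ 2 with hG
  have hGpos : 0 < G := mul_pos (by positivity) (Finset.sum_pos' (fun x _ => sq_nonneg _)
    ⟨0, Finset.mem_univ _, by simp [hg]⟩)
  -- Since |g| ≤ 1, the bound c·e ≤ 1 keeps 1 + c e g nonnegative, so the absolute value in the norm
  -- can be dropped.
  have norm_eq : ∀ (r c e : ℝ), 0 < r → 0 ≤ c * e → c * e ≤ 1 →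
      cyclicLpNorm n r (fun x => ((1 + c * e * g x : ℝ) : ℂ))
        = ((n : ℝ)⁻¹ * ∑ x, (1 + c * g x * e) ^ r) ^ (1 / r) := by
    intro r c e hr h0 h1
    rw [cyclicLpNorm_eq n r hr]
    congr 2
    refine Finset.sum_congr rfl fun x _ => ?_
    have := abs_le.1 (hg1 x)
    rw [Complex.norm_real, Real.norm_of_nonneg (by nlinarith), mul_right_comm]
  by_contra! hlt
  have hs : 0 < Real.exp (-t) := Real.exp_pos _
  have hP := hasDerivWithinAt_norm_perturbation n g hg0 (zero_lt_one.trans hp) 1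
  have hQ := hasDerivWithinAt_norm_perturbation n g hg0 (zero_lt_one.trans hq) (Real.exp (-t))
  have hD := (hP.sub hQ)
  rw [hasDerivWithinAt_iff_tendsto_slope' (by simp)] at hD
  -- In h = ε², both norms equal 1 at 0 and the contraction orders them for small h > 0, so their
  -- right derivatives are ordered as well.
  have hnonneg := ge_of_tendsto (b := 0) hD (by
    have hm : Set.Ioo (0 : ℝ) (min 1 (Real.exp t ^ 2)) ∈ nhdsWithin 0 (Set.Ioi 0) :=
      Ioo_mem_nhdsGT (by positivity)
    refine Filter.eventually_of_mem hm fun y hy => ?_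
    have hy0 : 0 < y := hy.1
    have hy1 : √y ≤ 1 := Real.sqrt_le_one.2 (hy.2.le.trans (min_le_left _ _))
    have hy2 : √y ≤ Real.exp t := Real.sqrt_le_iff.2
      ⟨(Real.exp_pos t).le, hy.2.le.trans (min_le_right _ _)⟩
    have hy3 : Real.exp (-t) * √y ≤ 1 := by
      rw [Real.exp_neg, inv_mul_le_iff₀ (Real.exp_pos t), mul_one]
      exact hy2
    have h1 := h (fun x => ((1 + √y * g x : ℝ) : ℂ))
    rw [poissonSemigroup_perturbation n hn] at h1
    have e1 := norm_eq q (Real.exp (-t)) (√y) (by linarith) (by positivity) hy3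
    have e2 := norm_eq p 1 (√y) (by linarith) (by positivity) (by linarith)
    rw [one_mul] at e2
    change cyclicLpNorm n q (fun x => ((1 + Real.exp (-t) * √y * g x : ℝ) : ℂ)) ≤ _ at h1
    rw [e1, e2] at h1
    rw [slope_def_field]
    refine div_nonneg ?_ (by linarith)
    simp only [Pi.sub_apply, Real.sqrt_zero, mul_zero, add_zero, Real.one_rpow, sub_self,
      Finset.sum_const, Finset.card_univ, ZMod.card, nsmul_eq_mul, mul_one,
      inv_mul_cancel₀ hn0.ne', sub_zero]
    linarith)
  have hp1 : 0 < p - 1 := by linarith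
  have h2 : 0 ≤ (p - 1) - (q - 1) * Real.exp (-t) ^ 2 := by
    rw [← hG] at hnonneg
    have : (p - 1) / 2 * 1 ^ 2 * G - (q - 1) / 2 * Real.exp (-t) ^ 2 * G
        = G / 2 * ((p - 1) - (q - 1) * Real.exp (-t) ^ 2) := by ring
    rw [this] at hnonneg
    exact nonneg_of_mul_nonneg_right hnonneg (by positivity)
  have h3 : Real.exp (2 * t) < (q - 1) / (p - 1) := by
    rw [← Real.lt_log_iff_exp_lt (div_pos (by linarith) hp1)]
    linarith
  rw [lt_div_iff₀ hp1] at h3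
  have h4 : Real.exp (-t) ^ 2 * Real.exp (2 * t) = 1 := by
    rw [sq, ← Real.exp_add, ← Real.exp_add, ← Real.exp_zero]
    ring_nf
  nlinarith [Real.exp_pos (2 * t)]

end

theorem theorem1p1 (n : ℕ) [NeZero n] (hn : ∃ k : ℕ, 1 ≤ k ∧ (n = 3 * 2 ^ k ∨ n = 2 ^ k))
    (p q : ℝ) (hp : 1 < p) (hpq : p ≤ q) (t : ℝ) (ht : 0 ≤ t) :
    (∀ f : ZMod n → ℂ, cyclicLpNorm n q (poissonSemigroup n t f) ≤ cyclicLpNorm n p f) ↔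
      (1 / 2) * Real.log ((q - 1) / (p - 1)) ≤ t := by
  obtain ⟨m, hm⟩ : ∃ m, n = 2 * m := by
    obtain ⟨k, hk, h⟩ := hn
    obtain ⟨j, rfl⟩ : ∃ j, k = j + 1 := ⟨k - 1, by omega⟩
    rcases h with h | h
    · exact ⟨3 * 2 ^ j, by rw [h, pow_succ]; ring⟩
    · exact ⟨2 ^ j, by rw [h, pow_succ]; ring⟩
  have h0 := NeZero.pos n
  exact ⟨le_of_poissonSemigroup_hypercontractive n (by omega) hp (hp.trans_le hpq),
    fun h f => poissonSemigroup_hypercontractive hm hp hpq ht h f⟩
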